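/- An operator algebra is a complex Banach algebra $A$ (not necessarily unital) with norms on all matrix spaces $M_n(A)$ (that of $M_1(A)=A$ being the norm of $A$), for which there is a completely isometric homomorphism $A\to B(H)$ for some Hilbert space $H$, and which has a contractive approximate identity. A homomorphism $\alpha: A\to B(H)$ is completely isometric if for every $n$ the map $M_n(A)\to M_n(B(H))=B(H^n)$, $(a_{ij})\mapsto(\alpha(a_{ij}))$, is isometric. For Hilbert spaces $H,K$, a $\sigma$-TRO is a norm closed subspace $M\subseteq B(H,K)$ with $MM^*M\subseteq M$ for which there are sequences $(m_i)_{i\ge1},(n_i)_{i\ge1}$ in $M$ such that, in norm, $\lim_l\sum_{i=1}^l m_im_i^*m=m$ and $\lim_l\sum_{i=1}^l m\,n_i^*n_i=m$ for all $m\in M$, and $\|\sum_{i=1}^l m_im_i^*\|\le1$, $\|\sum_{i=1}^l n_i^*n_i\|\le1$ for all $l$. Operator algebras $A$ and $B$ are $\sigma$-strongly $\Delta$-equivalent, $A\sim_{\sigma\Delta}B$, if there are Hilbert spaces $H,K$, completely isometric homomorphisms $\alpha:A\to B(H)$, $\beta:B\to B(K)$ and a $\sigma$-TRO $M\subseteq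 B(H,K)$ such that $$\alpha(A)=\overline{[M^*\beta(B)M]}^{\|\cdot\|},\qquad \beta(B)=\overline{[M\alpha(A)M^*]}^{\|\cdot\|},$$ where $[S]$ denotes the linear span of $S$. **Theorem.** The relation $\sim_{\sigma\Delta}$ is an equivalence relation (reflexive, symmetric and transitive) on the class of operator algebras. -/

import Mathlib

open Filter Topology ContinuousLinearMap

universe u v w

section Concrete

variable {H : Type v} [NormedAddCommGroup H] [InnerProductSpace ℂ H] [CompleteSpace H]
variable {K : Type w} [NormedAddCommGroup K] [InnerProductSpace ℂ K] [CompleteSpace K]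

/-- The identification `Mₙ(B(H)) = B(Hⁿ)`: the operator on the Hilbert space direct sum of `n`
copies of `H` given by the matrix `T`, that is, `(T x) i = ∑ j, T i j (x j)`. -/
noncomputable def matrixOperator {n : ℕ} (T : Matrix (Fin n) (Fin n) (H →L[ℂ] H)) :
    PiLp 2 (fun _ : Fin n => H) →L[ℂ] PiLp 2 (fun _ : Fin n => H) :=
  ((PiLp.continuousLinearEquiv 2 ℂ (fun _ : Fin n => H)).symm :
      (Fin n → H) →L[ℂ] PiLp 2 (fun _ : Fin n => H)) ∘L
    ContinuousLinearMap.pi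
      (fun i => ∑ j, T i j ∘L (PiLp.proj 2 (fun _ : Fin n => H) j : _ →L[ℂ] H))

/-- `M ⊆ B(H, K)` is a σ-TRO: a norm closed subspace with `M M* M ⊆ M` and with sequences
`mᵢ, nᵢ ∈ M` such that, in norm, `∑ mᵢ mᵢ* x = x` and `∑ x nᵢ* nᵢ = x` for all `x ∈ M`, all
partial sums of `∑ mᵢ mᵢ*` and of `∑ nᵢ* nᵢ` being contractions. -/
structure IsSigmaTRO (M : Submodule ℂ (H →L[ℂ] K)) : Prop where
  isClosed : IsClosed (M : Set (H →L[ℂ] K))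
  triple_mem : ∀ x ∈ M, ∀ y ∈ M, ∀ z ∈ M, x ∘L adjoint y ∘L z ∈ M
  exists_left : ∃ m : ℕ → (H →L[ℂ] K), (∀ i, m i ∈ M) ∧
    (∀ x ∈ M, Tendsto (fun l : ℕ => ∑ i ∈ Finset.range l, m i ∘L adjoint (m i) ∘L x)
      atTop (𝓝 x)) ∧
    ∀ l : ℕ, ‖∑ i ∈ Finset.range l, m i ∘L adjoint (m i)‖ ≤ 1
  exists_right : ∃ n : ℕ → (H →L[ℂ] K), (∀ i, n i ∈ M) ∧
    (∀ x ∈ M, Tendsto (fun l : ℕ => ∑ i ∈ Finset.range l, x ∘L adjoint (n i) ∘L n i)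
      atTop (𝓝 x)) ∧
    ∀ l : ℕ, ‖∑ i ∈ Finset.range l, adjoint (n i) ∘L n i‖ ≤ 1

/-- σ-strong TRO-equivalence of subalgebras `A ⊆ B(H)` and `B ⊆ B(K)`: there is a σ-TRO
`M ⊆ B(H, K)` such that `A` is the norm closed linear span of `M* B M` and `B` is the norm closed
linear span of `M A M*`. -/
def SigmaTROEquiv (A : NonUnitalSubalgebra ℂ (H →L[ℂ] H))
    (B : NonUnitalSubalgebra ℂ (K →L[ℂ] K)) : Prop :=
  ∃ M : Submodule ℂ (H →L[ℂ] K), IsSigmaTRO M ∧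
    (A : Set (H →L[ℂ] H)) = closure (Submodule.span ℂ
      {x | ∃ m₁ ∈ M, ∃ b ∈ B, ∃ m₂ ∈ M, x = adjoint m₁ ∘L b ∘L m₂} : Set (H →L[ℂ] H)) ∧
    (B : Set (K →L[ℂ] K)) = closure (Submodule.span ℂ
      {y | ∃ m₁ ∈ M, ∃ a ∈ A, ∃ m₂ ∈ M, y = m₁ ∘L a ∘L adjoint m₂} : Set (K →L[ℂ] K))

end Concrete

/-- An (abstract) operator algebra with a contractive approximate identity: a complex Banach
algebra, not necessarily unital, with norms on all the spaces `Mₙ(A)` extending the norm of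
`A = M₁(A)`, for which there is a completely isometric homomorphism into the bounded operators of
some Hilbert space. The axioms of an operator space follow from the existence of such a
homomorphism. -/
structure OperatorAlgebra where
  carrier : Type u
  [ring : NonUnitalNormedRing carrier]
  [normedSpace : NormedSpace ℂ carrier]
  [isScalarTower : IsScalarTower ℂ carrier carrier]
  [smulCommClass : SMulCommClass ℂ carrier carrier]
  [completeSpace : CompleteSpace carrier]
  /-- the norm of `Mₙ(A)` -/
  matrixNorm : ∀ n : ℕ, Matrix (Fin n) (Fin n) carrier → ℝ
  matrixNorm_one : ∀ a : carrier, matrixNorm 1 (Matrix.of fun _ _ => a) = ‖a‖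
  exists_representation : ∃ (H : Type u) (_ : NormedAddCommGroup H) (_ : InnerProductSpace ℂ H)
    (_ : CompleteSpace H) (α : carrier →ₙₐ[ℂ] (H →L[ℂ] H)),
    ∀ (n : ℕ) (a : Matrix (Fin n) (Fin n) carrier), ‖matrixOperator (a.map α)‖ = matrixNorm n a
  exists_approximateIdentity : ∃ l : Filter carrier, l.IsApproximateUnit ∧ ∀ᶠ e in l, ‖e‖ ≤ 1

namespace OperatorAlgebra

attribute [instance] ring normedSpace isScalarTower smulCommClass completeSpace

/-- A homomorphism `α : A → B(H)` is completely isometric if all its amplifications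
`Mₙ(A) → Mₙ(B(H)) = B(Hⁿ)` are isometric. -/
def IsCompletelyIsometric (A : OperatorAlgebra.{u}) {H : Type v} [NormedAddCommGroup H]
    [InnerProductSpace ℂ H] [CompleteSpace H] (α : A.carrier →ₙₐ[ℂ] (H →L[ℂ] H)) : Prop :=
  ∀ (n : ℕ) (a : Matrix (Fin n) (Fin n) A.carrier), ‖matrixOperator (a.map α)‖ = A.matrixNorm n a

/-- σ-strong Δ-equivalence: the operator algebras have completely isometric representations on
Hilbert spaces whose images are σ-strongly TRO-equivalent. -/
def SigmaStrongDeltaEquiv (A B : OperatorAlgebra.{u}) : Prop :=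
  ∃ (H : Type u) (_ : NormedAddCommGroup H) (_ : InnerProductSpace ℂ H) (_ : CompleteSpace H)
    (K : Type u) (_ : NormedAddCommGroup K) (_ : InnerProductSpace ℂ K) (_ : CompleteSpace K)
    (α : A.carrier →ₙₐ[ℂ] (H →L[ℂ] H)) (β : B.carrier →ₙₐ[ℂ] (K →L[ℂ] K)),
    A.IsCompletelyIsometric α ∧ B.IsCompletelyIsometric β ∧
      SigmaTROEquiv (NonUnitalAlgHom.range α) (NonUnitalAlgHom.range β)

end OperatorAlgebra

/-! Reflexivity uses the σ-TRO `ℂ·1` and symmetry replaces `M` by `M*`. The content is transitivity.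
If `α(A)` and `β(B)` are linked by `M`, and `β'(B)` and `γ(C)` by `N`, then `β` and `β'` are
unrelated representations of `B`, so `N` and `M` cannot be multiplied directly.

The first task is to move `α` next to `β'`. A right unit `(nᵢ)` of `M` is a contractive column `C :
H → K^∞` with `C*Cα(a) = α(a) = α(a)C*C`, so `a ↦ Cα(a)C*` is a completely isometric copy of `A`
inside the stabilization of `β(B)`, the norm closure of the finite matrices over `β(B)`. The
stabilizations of `β(B)` and `β'(B)` are completely isometrically isomorphic, and the isomorphism
carries this copy to a representation `α'` on `K'^∞`. An element `m` of `M` becomes `G m C*`, with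
`G` the embedding of `K` as summand 0. This operator and its adjoint are two-sided multipliers of
the stabilization. Such multipliers are transported as weak limits along an approximate unit.
Adjoints are respected because self-adjointness can be read off from norms: `‖1 + itT‖² ≤ 1 +
t²‖T‖²` for all real `t` (`exists_selfAdjoint_multiplier`).

The second task is to avoid checking that transported or multiplied families are σ-TROs. They are
handled as links (`IsLink`): countable families with module conditions relative to the two algebras
and an intermediate space, plus two density conditions. Links survive the transport
(`exists_isLink_of_sigmaTROEquiv`) and compose by multiplication (`IsLink.trans`). A σ-TRO yields a
link through its two unit sequences (`IsSigmaTRO.exists_isLink`). Conversely, all operators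
satisfying the module conditions form a closed TRO; inside it the countable family generates a
separable closed TRO, and separable closed TROs are σ-TROs (`IsLink.sigmaTROEquiv`). -/

set_option linter.unusedSectionVars false

/-! ### Closed spans, limits and composition maps -/

section General

/-- Uniformly Lipschitz families converging to the identity on a set do so on its closure. -/
theorem tendsto_self_of_mem_closure {ι E : Type*} [SeminormedAddCommGroup E] {l : Filter ι}
    {f : ι → E → E} {c : ℝ} (hf : ∀ᶠ i in l, ∀ x y, ‖f i x - f i y‖ ≤ c * ‖x - y‖) {s : Set E}
    (hs : ∀ x ∈ s, Tendsto (fun i => f i x) l (𝓝 x)) {x : E} (hx : x ∈ closure s) :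
    Tendsto (fun i => f i x) l (𝓝 x) := by
  rw [Metric.tendsto_nhds]
  intro ε hε
  have hc : 0 < |c| + 2 := by positivity
  -- The three terms of the triangle inequality contribute weights `|c|`, `1` and `1`.
  obtain ⟨y, hy, hxy⟩ := Metric.mem_closure_iff.1 hx (ε / (|c| + 2)) (by positivity)
  filter_upwards [hf, Metric.tendsto_nhds.1 (hs y hy) (ε / (|c| + 2)) (by positivity)] with i hi hiy
  rw [dist_eq_norm] at *
  have h1 := hi x y
  have h2 : ‖f i x - x‖ ≤ ‖f i x - f i y‖ + ‖f i y - y‖ + ‖x - y‖ := by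
    have : f i x - x = (f i x - f i y) + (f i y - y) - (x - y) := by abel
    rw [this]
    exact (norm_sub_le _ _).trans (add_le_add_left (norm_add_le _ _) _)
  have h3 : c * ‖x - y‖ ≤ |c| * (ε / (|c| + 2)) :=
    (mul_le_mul_of_nonneg_right (le_abs_self c) (norm_nonneg _)).trans
      (mul_le_mul_of_nonneg_left hxy.le (abs_nonneg _))
  have h4 : |c| * (ε / (|c| + 2)) + ε / (|c| + 2) + ε / (|c| + 2) = ε := by
    field_simp
    ring
  linarith

/-- A submodule which contains a set contains the closed span if it is closed. -/
theorem Submodule.closure_span_subset {E : Type*} [NormedAddCommGroup E] [NormedSpace ℂ E]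
    {s : Set E} {P : Submodule ℂ E} (hP : IsClosed (P : Set E)) (h : s ⊆ P) :
    closure (Submodule.span ℂ s : Set E) ⊆ P :=
  closure_minimal (Submodule.span_le.2 h) hP

/-- A continuous linear map sends a closed span into a closed submodule if it sends the generators
there. -/
theorem ContinuousLinearMap.map_mem_of_mem_closure_span {E F : Type*} [NormedAddCommGroup E]
    [NormedSpace ℂ E] [NormedAddCommGroup F] [NormedSpace ℂ F] (f : E →L[ℂ] F) {s : Set E}
    {P : Submodule ℂ F} (hP : IsClosed (P : Set F)) (h : ∀ x ∈ s, f x ∈ P) {x : E}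
    (hx : x ∈ closure (Submodule.span ℂ s : Set E)) : f x ∈ P :=
  Submodule.closure_span_subset (P := P.comap f.toLinearMap) (hP.preimage f.continuous) h hx

end General

section Compositions

variable {E F G : Type*} [NormedAddCommGroup E] [NormedSpace ℂ E] [NormedAddCommGroup F]
  [NormedSpace ℂ F] [NormedAddCommGroup G] [NormedSpace ℂ G]

/-- `x ↦ a ∘ x` as a continuous linear map. -/
noncomputable def leftComp (a : F →L[ℂ] G) : (E →L[ℂ] F) →L[ℂ] (E →L[ℂ] G) :=
  ContinuousLinearMap.compL ℂ E F G a

/-- `x ↦ x ∘ a` as a continuous linear map. -/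
noncomputable def rightComp (a : E →L[ℂ] F) : (F →L[ℂ] G) →L[ℂ] (E →L[ℂ] G) :=
  (ContinuousLinearMap.compL ℂ E F G).flip a

@[simp] theorem leftComp_apply (a : F →L[ℂ] G) (x : E →L[ℂ] F) : leftComp a x = a ∘L x := rfl

@[simp] theorem rightComp_apply (a : E →L[ℂ] F) (x : F →L[ℂ] G) : rightComp a x = x ∘L a := rfl

theorem comp_mem_of_mem_closure_span_left (a : F →L[ℂ] G) {s : Set (E →L[ℂ] F)}
    {P : Submodule ℂ (E →L[ℂ] G)} (hP : IsClosed (P : Set (E →L[ℂ] G))) (h : ∀ x ∈ s, a ∘L x ∈ P)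
    {x : E →L[ℂ] F} (hx : x ∈ closure (Submodule.span ℂ s : Set (E →L[ℂ] F))) : a ∘L x ∈ P :=
  (leftComp a).map_mem_of_mem_closure_span hP h hx

theorem comp_mem_of_mem_closure_span_right (a : E →L[ℂ] F) {s : Set (F →L[ℂ] G)}
    {P : Submodule ℂ (E →L[ℂ] G)} (hP : IsClosed (P : Set (E →L[ℂ] G))) (h : ∀ x ∈ s, x ∘L a ∈ P)
    {x : F →L[ℂ] G} (hx : x ∈ closure (Submodule.span ℂ s : Set (F →L[ℂ] G))) : x ∘L a ∈ P :=
  (rightComp a).map_mem_of_mem_closure_span hP h hx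

theorem sum_comp {ι : Type*} (s : Finset ι) (f : ι → F →L[ℂ] G) (x : E →L[ℂ] F) :
    (∑ i ∈ s, f i) ∘L x = ∑ i ∈ s, f i ∘L x :=
  map_sum (rightComp x) f s

theorem comp_sum {ι : Type*} (s : Finset ι) (f : ι → E →L[ℂ] F) (x : F →L[ℂ] G) :
    x ∘L (∑ i ∈ s, f i) = ∑ i ∈ s, x ∘L f i :=
  map_sum (leftComp x) f s

end Compositions

/-! ### Orthogonal systems of isometries and block operators -/

section Orthonormal

variable {ι κ : Type*}
variable {H : Type*} [NormedAddCommGroup H] [InnerProductSpace ℂ H] [CompleteSpace H]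
variable {K : Type*} [NormedAddCommGroup K] [InnerProductSpace ℂ K] [CompleteSpace K]
variable {P : Type*} [NormedAddCommGroup P] [InnerProductSpace ℂ P] [CompleteSpace P]
variable {Q : Type*} [NormedAddCommGroup Q] [InnerProductSpace ℂ Q] [CompleteSpace Q]

/-- A family of isometries `H → P` with pairwise orthogonal ranges. -/
def IsOrthoSystem (E : ι → H →L[ℂ] P) : Prop :=
  (∀ i, adjoint (E i) ∘L E i = .id ℂ H) ∧ ∀ i j, i ≠ j → adjoint (E i) ∘L E j = 0

namespace IsOrthoSystem

theorem comp_injective {E : ι → H →L[ℂ] P} (hE : IsOrthoSystem E) {f : κ → ι}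
    (hf : Function.Injective f) : IsOrthoSystem (fun k => E (f k)) :=
  ⟨fun _ => hE.1 _, fun _ _ hij => hE.2 _ _ (hf.ne hij)⟩

theorem prod {E : ι → H →L[ℂ] P} (hE : IsOrthoSystem E) {F : κ → P →L[ℂ] Q}
    (hF : IsOrthoSystem F) : IsOrthoSystem (fun p : κ × ι => F p.1 ∘L E p.2) := by
  refine ⟨fun p => ?_, fun p q hpq => ?_⟩
  · rw [adjoint_comp, comp_assoc, ← comp_assoc _ _ (E p.2), hF.1, id_comp, hE.1]
  · rw [adjoint_comp, comp_assoc, ← comp_assoc _ _ (E q.2)]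
    by_cases h : p.1 = q.1
    · rw [h, hF.1, id_comp]
      exact hE.2 _ _ fun h' => hpq (Prod.ext h h')
    · rw [hF.2 _ _ h, zero_comp, comp_zero]

variable {E : ι → H →L[ℂ] P} (hE : IsOrthoSystem E)
include hE

theorem adjoint_apply_apply [DecidableEq ι] (i j : ι) (x : H) :
    adjoint (E i) (E j x) = if i = j then x else 0 := by
  split_ifs with h
  · subst h; exact congr($(hE.1 i) x)
  · exact congr($(hE.2 i j h) x)

theorem norm_sum_sq (s : Finset ι) (x : ι → H) :
    ‖∑ i ∈ s, E i (x i)‖ ^ 2 = ∑ i ∈ s, ‖x i‖ ^ 2 := by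
  classical
  have : (inner ℂ (∑ i ∈ s, E i (x i)) (∑ i ∈ s, E i (x i)) : ℂ)
      = ∑ i ∈ s, ((‖x i‖ ^ 2 : ℝ) : ℂ) := by
    rw [sum_inner]
    refine Finset.sum_congr rfl fun i hi => ?_
    rw [inner_sum, Finset.sum_eq_single i]
    · rw [← adjoint_inner_right, hE.adjoint_apply_apply, if_pos rfl, inner_self_eq_norm_sq_to_K]
      push_cast; rfl
    · intro j _ hj
      rw [← adjoint_inner_right, hE.adjoint_apply_apply, if_neg hj.symm, inner_zero_right]
    · exact fun h => absurd hi h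
  rw [inner_self_eq_norm_sq_to_K, ← Complex.ofReal_sum] at this
  apply Complex.ofReal_injective
  rw [← this]
  simp

/-- Bessel's inequality. `S` is both the squared norm of `∑ Eᵢ Eᵢ* v` and its inner product with
`v`, so Cauchy–Schwarz gives `S² ≤ S ‖v‖²`. -/
theorem sum_norm_adjoint_sq_le (s : Finset ι) (v : P) :
    ∑ i ∈ s, ‖adjoint (E i) v‖ ^ 2 ≤ ‖v‖ ^ 2 := by
  set S := ∑ i ∈ s, ‖adjoint (E i) v‖ ^ 2 with hS
  have hS0 : 0 ≤ S := Finset.sum_nonneg fun _ _ => by positivity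
  have h1 : ‖∑ i ∈ s, E i (adjoint (E i) v)‖ ^ 2 = S := hE.norm_sum_sq s _
  have h2 : (inner ℂ (∑ i ∈ s, E i (adjoint (E i) v)) v : ℂ) = (S : ℂ) := by
    rw [sum_inner, hS]
    push_cast
    refine Finset.sum_congr rfl fun i _ => ?_
    rw [← adjoint_inner_right, inner_self_eq_norm_sq_to_K]; rfl
  have h3 := norm_inner_le_norm (𝕜 := ℂ) (∑ i ∈ s, E i (adjoint (E i) v)) v
  rw [h2, Complex.norm_real, Real.norm_of_nonneg hS0] at h3
  by_contra hlt
  push Not at hlt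
  have h4 : S ^ 2 ≤ S * ‖v‖ ^ 2 := by
    rw [← h1, ← mul_pow, h1]
    exact pow_le_pow_left₀ hS0 h3 2
  nlinarith [sq_nonneg ‖v‖]

/-- Pythagoras on the side of `F` and Bessel on the side of `E`. -/
theorem norm_diagonal_le {F : ι → K →L[ℂ] Q} (hF : IsOrthoSystem F) (s : Finset ι)
    (X : H →L[ℂ] K) : ‖∑ i ∈ s, F i ∘L X ∘L adjoint (E i)‖ ≤ ‖X‖ := by
  refine opNorm_le_bound _ (norm_nonneg _) fun v => ?_
  refine le_of_sq_le_sq ?_ (by positivity)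
  simp only [sum_apply, comp_apply]
  rw [hF.norm_sum_sq, mul_pow]
  refine le_trans ?_ (mul_le_mul_of_nonneg_left (hE.sum_norm_adjoint_sq_le s v) (by positivity))
  rw [Finset.mul_sum]
  refine Finset.sum_le_sum fun i _ => ?_
  rw [← mul_pow]
  exact pow_le_pow_left₀ (norm_nonneg _) (le_opNorm _ _) 2

end IsOrthoSystem

/-- The operator `∑ Eᵢ Tᵢⱼ Eⱼ*` with matrix `T` along the system `E`. -/
noncomputable def blockOperator [Fintype ι] (E : ι → H →L[ℂ] P) (T : ι → ι → H →L[ℂ] H) :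
    P →L[ℂ] P :=
  ∑ i, ∑ j, E i ∘L T i j ∘L adjoint (E j)

theorem map_ite_zero {V W : Type*} [NormedAddCommGroup V] [NormedSpace ℂ V] [NormedAddCommGroup W]
    [NormedSpace ℂ W] (f : V →L[ℂ] W) (c : Prop) [Decidable c] (x : V) :
    f (if c then x else 0) = if c then f x else 0 := by
  rw [apply_ite f, map_zero]

theorem blockOperator_conj [Fintype ι] [DecidableEq ι] {E : ι → H →L[ℂ] P} (hE : IsOrthoSystem E)
    (F : ι → K →L[ℂ] Q) (X : H →L[ℂ] K) (Y : K →L[ℂ] H) (T : ι → ι → H →L[ℂ] H) :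
    (∑ i, F i ∘L X ∘L adjoint (E i)) ∘L blockOperator E T ∘L (∑ i, E i ∘L Y ∘L adjoint (F i)) =
      blockOperator F (fun i j => X ∘L T i j ∘L Y) := by
  ext v
  simp only [blockOperator, comp_apply, sum_apply, map_sum, hE.adjoint_apply_apply, map_ite_zero,
    Finset.sum_ite_eq', Finset.mem_univ, if_true]
  exact Finset.sum_comm

/-- Acting entrywise by `X` and `Y` is multiplication by two diagonal contractions. With identities
this shows that the norm of a matrix does not depend on the system; with `C` and `C*` it controls
the compression by the column. -/
theorem norm_blockOperator_conj_le [Fintype ι] {E : ι → H →L[ℂ] P} (hE : IsOrthoSystem E)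
    {F : ι → K →L[ℂ] Q} (hF : IsOrthoSystem F) {X : H →L[ℂ] K} {Y : K →L[ℂ] H} (hX : ‖X‖ ≤ 1)
    (hY : ‖Y‖ ≤ 1) (T : ι → ι → H →L[ℂ] H) :
    ‖blockOperator F (fun i j => X ∘L T i j ∘L Y)‖ ≤ ‖blockOperator E T‖ := by
  classical
  rw [← blockOperator_conj hE]
  have h1 := (hE.norm_diagonal_le hF Finset.univ X).trans hX
  have h2 := (hF.norm_diagonal_le hE Finset.univ Y).trans hY
  calc _ ≤ _ := opNorm_comp_le _ _
    _ ≤ 1 * (‖blockOperator E T‖ * 1) := by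
      gcongr
      exact (opNorm_comp_le _ _).trans (by gcongr)
    _ = _ := by ring

theorem norm_blockOperator_eq [Fintype ι] {E : ι → H →L[ℂ] P} (hE : IsOrthoSystem E)
    {F : ι → H →L[ℂ] Q} (hF : IsOrthoSystem F) (T : ι → ι → H →L[ℂ] H) :
    ‖blockOperator E T‖ = ‖blockOperator F T‖ :=
  le_antisymm (norm_blockOperator_conj_le hF hE norm_id_le norm_id_le T)
    (norm_blockOperator_conj_le hE hF norm_id_le norm_id_le T)

theorem isOrthoSystem_unique [Unique ι] : IsOrthoSystem (fun _ : ι => ContinuousLinearMap.id ℂ H) :=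
  ⟨fun _ => by ext; simp [← star_eq_adjoint, ← one_def], fun i j h => absurd (Subsingleton.elim i j) h⟩

theorem blockOperator_reindex [Fintype ι] [Fintype κ] (e : ι ≃ κ) (E : κ → H →L[ℂ] P)
    (T : κ → κ → H →L[ℂ] H) :
    blockOperator (fun i => E (e i)) (fun i j => T (e i) (e j)) = blockOperator E T := by
  unfold blockOperator
  rw [← e.sum_comp]
  exact Finset.sum_congr rfl fun i _ => (e.sum_comp fun j => E (e i) ∘L T (e i) j ∘L adjoint (E j))

/-- The coordinate embeddings of a finite Hilbert space direct sum. -/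
noncomputable def coordEmbedding (H : Type*) [NormedAddCommGroup H] [InnerProductSpace ℂ H]
    [CompleteSpace H] (n : ℕ) (i : Fin n) : H →L[ℂ] PiLp 2 (fun _ : Fin n => H) :=
  adjoint (PiLp.proj 2 (fun _ : Fin n => H) i : PiLp 2 (fun _ : Fin n => H) →L[ℂ] H)

theorem coordEmbedding_apply (n : ℕ) (i : Fin n) (x : H) :
    coordEmbedding H n i x = PiLp.single 2 i x := by
  refine ext_inner_right ℂ fun y => ?_
  rw [coordEmbedding, adjoint_inner_left, PiLp.inner_apply, Finset.sum_eq_single i]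
  · simp
  · intro j _ hj
    simp [hj]
  · simp

theorem isOrthoSystem_coordEmbedding (n : ℕ) : IsOrthoSystem (coordEmbedding H n) := by
  refine ⟨fun i => ?_, fun i j hij => ?_⟩
  · ext x
    simp only [comp_apply, coordEmbedding_apply]
    simp [coordEmbedding]
  · ext x
    simp only [comp_apply, coordEmbedding_apply]
    simp [coordEmbedding, hij]

theorem matrixOperator_eq_blockOperator {n : ℕ} (T : Matrix (Fin n) (Fin n) (H →L[ℂ] H)) :
    matrixOperator T = blockOperator (coordEmbedding H n) T := by
  ext x i
  simp only [matrixOperator, blockOperator, comp_apply, sum_apply, coordEmbedding_apply]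
  simp only [coordEmbedding, adjoint_adjoint]
  simp only [WithLp.ofLp_sum, Finset.sum_apply, PiLp.ofLp_single]
  rw [Finset.sum_eq_single i]
  · simp
  · intro j _ hj
    simp [hj.symm]
  · simp

namespace OperatorAlgebra

variable {A : OperatorAlgebra.{u}} {α : A.carrier →ₙₐ[ℂ] (H →L[ℂ] H)}
  {α' : A.carrier →ₙₐ[ℂ] (K →L[ℂ] K)}

/-- Frees complete isometry from the coordinates of `Hⁿ`: both norms equal the matrix norm of `a`,
for any finite index type and any orthogonal systems. -/
theorem IsCompletelyIsometric.norm_blockOperator [Fintype ι] (h : A.IsCompletelyIsometric α)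
    (h' : A.IsCompletelyIsometric α') {E : ι → H →L[ℂ] P} (hE : IsOrthoSystem E)
    {F : ι → K →L[ℂ] Q} (hF : IsOrthoSystem F) (a : ι → ι → A.carrier) :
    ‖blockOperator E (fun i j => α (a i j))‖ = ‖blockOperator F (fun i j => α' (a i j))‖ := by
  let e := Fintype.equivFin ι
  rw [← blockOperator_reindex e.symm, ← blockOperator_reindex e.symm,
    norm_blockOperator_eq (hE.comp_injective e.symm.injective) (isOrthoSystem_coordEmbedding _),
    norm_blockOperator_eq (hF.comp_injective e.symm.injective) (isOrthoSystem_coordEmbedding _)]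
  have h1 := h _ (Matrix.of fun i j => a (e.symm i) (e.symm j))
  have h2 := h' _ (Matrix.of fun i j => a (e.symm i) (e.symm j))
  rw [matrixOperator_eq_blockOperator] at h1 h2
  exact h1.trans h2.symm

theorem IsCompletelyIsometric.norm_map (h : A.IsCompletelyIsometric α) (a : A.carrier) :
    ‖α a‖ = ‖a‖ := by
  have h1 := norm_blockOperator_eq (isOrthoSystem_coordEmbedding (H := H) 1) isOrthoSystem_unique
    (fun _ _ => α a)
  have h2 : blockOperator (fun _ : Fin 1 => ContinuousLinearMap.id ℂ H) (fun _ _ => α a) = α a := by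
    ext x
    simp [blockOperator, ← star_eq_adjoint, ← one_def]
  rw [← A.matrixNorm_one, ← h, matrixOperator_eq_blockOperator, ← h2, ← h1]
  rfl

theorem IsCompletelyIsometric.isClosed_range (h : A.IsCompletelyIsometric α) :
    IsClosed (NonUnitalAlgHom.range α : Set (H →L[ℂ] H)) := by
  have hi : Isometry α := AddMonoidHomClass.isometry_of_norm α h.norm_map
  rw [NonUnitalAlgHom.coe_range]
  exact hi.isClosedEmbedding.isClosed_range

end OperatorAlgebra

end Orthonormal

/-! ### Weak operator limits and metric criteria for self-adjointness -/

section WeakLimit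

variable {ι : Type*} {K : Type*} [NormedAddCommGroup K] [InnerProductSpace ℂ K] [CompleteSpace K]

/-- Convergence of a family of operators in the weak operator topology. -/
def TendstoWeakly (f : ι → K →L[ℂ] K) (l : Filter ι) (T : K →L[ℂ] K) : Prop :=
  ∀ x y, Tendsto (fun i => inner ℂ x (f i y)) l (𝓝 (inner ℂ x (T y)))

/-- Bounded families have weak limits along ultrafilters. -/
theorem exists_tendstoWeakly (l : Ultrafilter ι) {f : ι → K →L[ℂ] K} {c : ℝ}
    (hf : ∀ᶠ i in (l : Filter ι), ‖f i‖ ≤ c) : ∃ T, TendstoWeakly f l T := by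
  have hb (x y : K) : ∀ᶠ i in (l : Filter ι), ‖(inner ℂ x (f i y) : ℂ)‖ ≤ c * ‖x‖ * ‖y‖ := by
    filter_upwards [hf] with i hi
    calc _ ≤ ‖x‖ * ‖f i y‖ := norm_inner_le_norm _ _
      _ ≤ ‖x‖ * (c * ‖y‖) := by gcongr; exact (f i).le_of_opNorm_le hi y
      _ = _ := by ring
  have hex (x y : K) : ∃ z : ℂ, Tendsto (fun i => (inner ℂ x (f i y) : ℂ)) l (𝓝 z) := by
    obtain ⟨z, -, hz⟩ := (isCompact_closedBall (0 : ℂ) (c * ‖x‖ * ‖y‖)).ultrafilter_le_nhds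
      (l.map fun i => (inner ℂ x (f i y) : ℂ)) (by
        rw [le_principal_iff]
        exact (hb x y).mono fun i hi => by simpa using hi)
    exact ⟨z, hz⟩
  -- Uniqueness of limits makes `B` sesquilinear and the bound `c` passes to it, so it is
  -- represented by an operator. That operator sits in the left slot of the inner product, hence the
  -- adjoint in the witness.
  choose B hB using hex
  let B₁ : K →ₗ⋆[ℂ] K →ₗ[ℂ] ℂ := LinearMap.mk₂'ₛₗ (starRingEnd ℂ) (RingHom.id ℂ) B
    (fun x x' y => tendsto_nhds_unique (hB _ _) (by
      simpa only [inner_add_left] using (hB x y).add (hB x' y)))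
    (fun a x y => tendsto_nhds_unique (hB _ _) (by
      simpa only [inner_smul_left, smul_eq_mul] using (hB x y).const_mul _))
    (fun x y y' => tendsto_nhds_unique (hB _ _) (by
      simpa only [map_add, inner_add_right] using (hB x y).add (hB x y')))
    (fun a x y => tendsto_nhds_unique (hB _ _) (by
      simpa only [map_smul, inner_smul_right, smul_eq_mul, RingHom.id_apply] using (hB x y).const_mul _))
  let B₂ : K →L⋆[ℂ] K →L[ℂ] ℂ := B₁.mkContinuous₂ c fun x y =>
    le_of_tendsto (hB x y).norm (hb x y)
  refine ⟨adjoint (InnerProductSpace.continuousLinearMapOfBilin B₂), fun x y => ?_⟩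
  rw [adjoint_inner_right, InnerProductSpace.continuousLinearMapOfBilin_apply]
  exact hB x y

namespace TendstoWeakly

variable {l : Filter ι} {f g : ι → K →L[ℂ] K} {S T : K →L[ℂ] K}

theorem unique [l.NeBot] (hS : TendstoWeakly f l S) (hT : TendstoWeakly f l T) : S = T := by
  ext y
  exact ext_inner_left ℂ fun x => tendsto_nhds_unique (hS x y) (hT x y)

theorem congr' (hS : TendstoWeakly f l S) (h : ∀ᶠ i in l, f i = g i) : TendstoWeakly g l S :=
  fun x y => (hS x y).congr' (h.mono fun i hi => by simp only [hi])

theorem of_tendsto (h : Tendsto f l (𝓝 T)) : TendstoWeakly f l T := fun _ y =>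
  ((continuous_const.inner ((ContinuousLinearMap.apply ℂ K y).continuous)).tendsto T).comp h

theorem mul_left (hT : TendstoWeakly f l T) (R : K →L[ℂ] K) :
    TendstoWeakly (fun i => R * f i) l (R * T) := fun x y => by
  have := hT (adjoint R x) y
  simp only [adjoint_inner_left] at this
  exact this

theorem mul_right (hT : TendstoWeakly f l T) (R : K →L[ℂ] K) :
    TendstoWeakly (fun i => f i * R) l (T * R) := fun x y => hT x (R y)

theorem add (hS : TendstoWeakly f l S) (hT : TendstoWeakly g l T) :
    TendstoWeakly (fun i => f i + g i) l (S + T) := fun x y => by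
  simpa only [add_apply, inner_add_right] using (hS x y).add (hT x y)

theorem smul (c : ℂ) (hT : TendstoWeakly f l T) :
    TendstoWeakly (fun i => c • f i) l (c • T) := fun x y => by
  simpa only [smul_apply, inner_smul_right] using (hT x y).const_mul c

theorem norm_le [l.NeBot] (hT : TendstoWeakly f l T) {c : ℝ} (hc : 0 ≤ c)
    (hf : ∀ᶠ i in l, ‖f i‖ ≤ c) : ‖T‖ ≤ c := by
  refine opNorm_le_bound _ hc fun y => ?_
  have h : ‖(inner ℂ (T y) (T y) : ℂ)‖ ≤ ‖T y‖ * (c * ‖y‖) := by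
    refine le_of_tendsto (hT (T y) y).norm (hf.mono fun i hi => ?_)
    exact (norm_inner_le_norm _ _).trans (by gcongr; exact (f i).le_of_opNorm_le hi y)
  rw [inner_self_eq_norm_sq_to_K] at h
  simp only [Complex.coe_algebraMap, norm_pow, Complex.norm_real, norm_norm] at h
  rcases (norm_nonneg (T y)).eq_or_lt with h0 | h0
  · rw [← h0]; positivity
  · exact le_of_mul_le_mul_left (by simpa [sq] using h) h0

end TendstoWeakly

/-- Near `t = 0` the linear term dominates; a small `t` of sign opposite to `a` gives the
contradiction. -/
theorem eq_zero_of_forall_quadratic_nonneg {a b : ℝ} (h : ∀ t : ℝ, 0 ≤ 2 * t * a + t ^ 2 * b) :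
    a = 0 := by
  by_contra ha
  have hb : 0 < |b| + 1 := by positivity
  have h1 := h (-a / (|b| + 1))
  have h2 : 2 * (-a / (|b| + 1)) * a + (-a / (|b| + 1)) ^ 2 * b
      = a ^ 2 * (b - 2 * (|b| + 1)) / (|b| + 1) ^ 2 := by
    field_simp
    ring
  rw [h2] at h1
  have h3 : a ^ 2 * (b - 2 * (|b| + 1)) / (|b| + 1) ^ 2 < 0 := by
    apply div_neg_of_neg_of_pos _ (by positivity)
    exact mul_neg_of_pos_of_neg (by positivity) (by linarith [le_abs_self b, abs_nonneg b])
  linarith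

theorem norm_add_smul_sq (u v : K) (t : ℝ) :
    ‖u + (t : ℂ) • v‖ ^ 2 = ‖u‖ ^ 2 + 2 * t * (inner ℂ u v).re + t ^ 2 * ‖v‖ ^ 2 := by
  rw [@norm_add_sq ℂ, inner_smul_right, norm_smul]
  simp only [Complex.norm_real, mul_pow, Real.norm_eq_abs, sq_abs, RCLike.re_to_complex,
    Complex.re_ofReal_mul]
  ring

/-- A contractive idempotent is self-adjoint. -/
theorem isSelfAdjoint_of_isIdempotentElem_of_norm_le_one {P : K →L[ℂ] K} (hP : IsIdempotentElem P)
    (hn : ‖P‖ ≤ 1) : IsSelfAdjoint P := by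
  have hPP (x : K) : P (P x) = P x := congr($hP.eq x)
  -- `P` maps `P x + t v` to `P x` without increasing norms, so `P x` is shortest in its coset of
  -- the kernel and hence orthogonal to the kernel.
  have hre (x v : K) (hv : P v = 0) : (inner ℂ (P x) v).re = 0 := by
    refine eq_zero_of_forall_quadratic_nonneg (b := ‖v‖ ^ 2) fun t => ?_
    have h1 : ‖P x‖ ≤ ‖P x + (t : ℂ) • v‖ := by
      have := P.le_of_opNorm_le hn (P x + (t : ℂ) • v)
      simpa [hPP, hv] using this
    have h2 := pow_le_pow_left₀ (norm_nonneg _) h1 2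
    rw [norm_add_smul_sq] at h2
    linarith
  have hort (x v : K) (hv : P v = 0) : (inner ℂ (P x) v : ℂ) = 0 := by
    apply Complex.ext (hre x v hv)
    have := hre x (Complex.I • v) (by rw [map_smul, hv, smul_zero])
    rw [inner_smul_right] at this
    simpa using this
  have hsub (x y : K) : (inner ℂ (P x) y : ℂ) = inner ℂ (P x) (P y) := by
    rw [← sub_eq_zero, ← inner_sub_right]
    exact hort x _ (by rw [map_sub, hPP, sub_self])
  rw [isSelfAdjoint_iff_isSymmetric]
  intro x y
  change (inner ℂ (P x) y : ℂ) = inner ℂ x (P y)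
  rw [hsub, ← inner_conj_symm x, hsub y x, inner_conj_symm]

end WeakLimit

/-! ### Isometric graphs and the transport of multipliers -/

section Multiplier

variable {K : Type*} [NormedAddCommGroup K] [InnerProductSpace ℂ K] [CompleteSpace K]
variable {K' : Type*} [NormedAddCommGroup K'] [InnerProductSpace ℂ K'] [CompleteSpace K']

/-- The graph of an isometric isomorphism between closed operator algebras on `K` and `K'` with
contractive approximate identities. -/
structure IsIsometricGraph (Γ : Submodule ℂ ((K →L[ℂ] K) × (K' →L[ℂ] K'))) : Prop where
  isClosed : IsClosed (Γ : Set ((K →L[ℂ] K) × (K' →L[ℂ] K')))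
  norm_eq : ∀ p ∈ Γ, ‖p.1‖ = ‖p.2‖
  mul_mem : ∀ p ∈ Γ, ∀ q ∈ Γ, p * q ∈ Γ
  exists_approximateUnit : ∃ l : Filter ((K →L[ℂ] K) × (K' →L[ℂ] K')), l.NeBot ∧
    (∀ᶠ e in l, e ∈ Γ ∧ ‖e‖ ≤ 1) ∧ ∀ p ∈ Γ,
      Tendsto (fun e => e * p) l (𝓝 p) ∧ Tendsto (fun e => p * e) l (𝓝 p)

namespace IsIsometricGraph

variable {Γ : Submodule ℂ ((K →L[ℂ] K) × (K' →L[ℂ] K'))} (hΓ : IsIsometricGraph Γ)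
include hΓ

theorem snd_unique {x : K →L[ℂ] K} {y z : K' →L[ℂ] K'} (hy : (x, y) ∈ Γ) (hz : (x, z) ∈ Γ) :
    y = z := by
  have := hΓ.norm_eq _ (Γ.sub_mem hy hz)
  simp only [Prod.mk_sub_mk, sub_self, norm_zero] at this
  exact sub_eq_zero.1 (norm_eq_zero.1 this.symm)

theorem tendsto_snd {ι : Type*} {l : Filter ι} {f : ι → K →L[ℂ] K} {g : ι → K' →L[ℂ] K'}
    {x : K →L[ℂ] K} {y : K' →L[ℂ] K'} (hfg : ∀ᶠ i in l, (f i, g i) ∈ Γ) (hxy : (x, y) ∈ Γ)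
    (hf : Tendsto f l (𝓝 x)) : Tendsto g l (𝓝 y) := by
  rw [tendsto_iff_norm_sub_tendsto_zero] at hf ⊢
  refine hf.congr' (hfg.mono fun i hi => ?_)
  exact hΓ.norm_eq _ (Γ.sub_mem hi hxy)

/-- The isometry carries Cauchy sequences across, and the graph is closed. Norm approximation in the
first algebra is therefore enough to obtain a partner in the second. -/
theorem exists_snd_of_tendsto {f : ℕ → K →L[ℂ] K} {x : K →L[ℂ] K} (hf : ∀ i, ∃ y, (f i, y) ∈ Γ)
    (hx : Tendsto f atTop (𝓝 x)) : ∃ y, (x, y) ∈ Γ := by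
  choose g hg using hf
  have hc : CauchySeq g := by
    rw [Metric.cauchySeq_iff]
    intro ε hε
    obtain ⟨N, hN⟩ := Metric.cauchySeq_iff.1 hx.cauchySeq ε hε
    refine ⟨N, fun m hm n hn => ?_⟩
    rw [dist_eq_norm, ← show _ = ‖g m - g n‖ from hΓ.norm_eq _ (Γ.sub_mem (hg m) (hg n))]
    simpa [dist_eq_norm] using hN m hm n hn
  obtain ⟨y, hy⟩ := cauchySeq_tendsto_of_complete hc
  exact ⟨y, hΓ.isClosed.mem_of_tendsto (hx.prodMk_nhds hy) (Eventually.of_forall hg)⟩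

/-- Multiplying by an algebra element upgrades the weak limit to a norm limit. On the right, `f(e)
p₂` is the partner of `T e p₁`, which tends to `T p₁`. On the left, `p₂ f(e)` is the partner of `(p₁
T) e`, which tends to `p₁ T` because `p₁ T` again lies in the first algebra. -/
theorem weakLimit_mul_mem {l : Filter ((K →L[ℂ] K) × (K' →L[ℂ] K'))} [l.NeBot]
    (hl : ∀ᶠ e in l, e ∈ Γ ∧ ‖e‖ ≤ 1)
    (hlim : ∀ p ∈ Γ, Tendsto (fun e => e * p) l (𝓝 p) ∧ Tendsto (fun e => p * e) l (𝓝 p))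
    {T : K →L[ℂ] K} {f : (K →L[ℂ] K) × (K' →L[ℂ] K') → K' →L[ℂ] K'}
    (hf : ∀ p ∈ Γ, (T * p.1, f p) ∈ Γ) (hT : ∀ p ∈ Γ, ∃ y, (p.1 * T, y) ∈ Γ)
    {T' : K' →L[ℂ] K'} (hT' : TendstoWeakly f l T') {p : (K →L[ℂ] K) × (K' →L[ℂ] K')}
    (hp : p ∈ Γ) : T' * p.2 = f p ∧ (p.1 * T, p.2 * T') ∈ Γ := by
  constructor
  · refine (hT'.mul_right p.2).unique (.of_tendsto ?_)
    refine hΓ.tendsto_snd (f := fun e => T * e.1 * p.1) ?_ (hf p hp) ?_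
    · filter_upwards [hl] with e he
      exact hΓ.mul_mem _ (hf e he.1) _ hp
    · have := ((continuous_fst.tendsto _).comp (hlim p hp).1).const_mul T
      simpa only [Function.comp_def, Prod.fst_mul, ← mul_assoc] using this
  · obtain ⟨y, hy⟩ := hT p hp
    have : p.2 * T' = y := by
      refine (hT'.mul_left p.2).unique (.of_tendsto ?_)
      refine hΓ.tendsto_snd (f := fun e => p.1 * (T * e.1)) ?_ hy ?_
      · filter_upwards [hl] with e he
        exact hΓ.mul_mem _ hp _ (hf e he.1)
      · have := (continuous_fst.tendsto _).comp (hlim _ hy).2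
        simpa only [Function.comp_def, Prod.fst_mul, mul_assoc] using this
    rwa [this]

/-- The C*-identity applied to `(1 + itT)*(1 + itT) = 1 + t²T²`. The absence of a term linear in `t`
is the trace of self-adjointness that an isometry can carry over. -/
theorem norm_one_add_smul_sq_le {T : K →L[ℂ] K} (hT : IsSelfAdjoint T) (t : ℝ) :
    ‖1 + (t * Complex.I : ℂ) • T‖ ^ 2 ≤ 1 + t ^ 2 * ‖T‖ ^ 2 := by
  have h : star (1 + (t * Complex.I : ℂ) • T) * (1 + (t * Complex.I : ℂ) • T)
      = 1 + ((t ^ 2 : ℝ) : ℂ) • (T * T) := by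
    rw [star_add, star_one, star_smul, hT.star_eq]
    simp only [add_mul, mul_add, one_mul, mul_one, smul_mul_assoc, mul_smul_comm]
    have h1 : star (t * Complex.I : ℂ) = -(t * Complex.I) := by simp
    have h2 : (t * Complex.I : ℂ) * -(t * Complex.I) = ((t ^ 2 : ℝ) : ℂ) := by
      rw [mul_neg, mul_mul_mul_comm, Complex.I_mul_I]; push_cast; ring
    rw [h1, smul_add, smul_smul, h2, neg_smul]
    abel
  rw [sq, ← CStarRing.norm_star_mul_self, h]
  refine (norm_add_le _ _).trans (add_le_add norm_id_le ?_)
  rw [norm_smul, Complex.norm_real, Real.norm_of_nonneg (sq_nonneg t), sq ‖T‖]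
  gcongr
  exact norm_mul_le _ _

/-- The graph isomorphism knows nothing of adjoints, since the algebras need not be self-adjoint.
`T'` is the weak limit of the partners of `T e` along an approximate unit, and its quadratic form is
real because the bound on `‖1 + itT‖` passes to it. -/
theorem exists_selfAdjoint_multiplier {T : K →L[ℂ] K} (hT : IsSelfAdjoint T)
    (hl : ∀ p ∈ Γ, ∃ y, (T * p.1, y) ∈ Γ) (hr : ∀ p ∈ Γ, ∃ y, (p.1 * T, y) ∈ Γ) :
    ∃ T' : K' →L[ℂ] K', IsSelfAdjoint T' ∧
      ∀ p ∈ Γ, (T * p.1, T' * p.2) ∈ Γ ∧ (p.1 * T, p.2 * T') ∈ Γ := by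
  obtain ⟨l₀, hl₀, hunit₀, hlim₀⟩ := hΓ.exists_approximateUnit
  choose! f hf using hl
  let l := Ultrafilter.of l₀
  have hle : (l : Filter _) ≤ l₀ := Ultrafilter.of_le l₀
  have hunit : ∀ᶠ e in (l : Filter _), e ∈ Γ ∧ ‖e‖ ≤ 1 := hle hunit₀
  have hlim : ∀ p ∈ Γ, Tendsto (fun e => e * p) l (𝓝 p) ∧ Tendsto (fun e => p * e) l (𝓝 p) :=
    fun p hp => ⟨(hlim₀ p hp).1.mono_left hle, (hlim₀ p hp).2.mono_left hle⟩
  have he1 {e : (K →L[ℂ] K) × (K' →L[ℂ] K')} (he : ‖e‖ ≤ 1) : ‖e.1‖ ≤ 1 := (norm_fst_le e).trans he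
  have he2 {e : (K →L[ℂ] K) × (K' →L[ℂ] K')} (he : ‖e‖ ≤ 1) : ‖e.2‖ ≤ 1 := (norm_snd_le e).trans he
  obtain ⟨T', hT'⟩ := exists_tendstoWeakly l (f := f) (c := ‖T‖) <| by
    filter_upwards [hunit] with e he
    rw [← hΓ.norm_eq _ (hf e he.1)]
    exact (norm_mul_le _ _).trans (mul_le_of_le_one_right (norm_nonneg _) (he1 he.2))
  -- The second algebra may act degenerately, so the limit `P` of its approximate unit replaces the
  -- identity. It is a contractive idempotent, hence a projection, and `T' = P T' = T' P`.
  obtain ⟨P, hP⟩ := exists_tendstoWeakly l (f := fun e : (K →L[ℂ] K) × (K' →L[ℂ] K') => e.2)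
    (c := 1) (hunit.mono fun e he => he2 he.2)
  have hTmul {p} (hp : p ∈ Γ) := hΓ.weakLimit_mul_mem hunit hlim hf hr hT' hp
  have hPmul {p} (hp : p ∈ Γ) := hΓ.weakLimit_mul_mem hunit hlim (T := 1)
    (fun p hp => by simpa using hp) (fun p hp => ⟨p.2, by simpa using hp⟩) hP hp
  have hPP : P * P = P := (hP.mul_left P).unique
    (hP.congr' (hunit.mono fun e he => (hPmul he.1).1.symm))
  have hPT : P * T' = T' := (hT'.mul_left P).unique
    (hT'.congr' (hunit.mono fun e he => (hPmul (hf e he.1)).1.symm))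
  have hTP : T' * P = T' := (hP.mul_left T').unique
    (hT'.congr' (hunit.mono fun e he => (hTmul he.1).1.symm))
  have hPsa : IsSelfAdjoint P := isSelfAdjoint_of_isIdempotentElem_of_norm_le_one hPP
    (hP.norm_le zero_le_one (hunit.mono fun e he => he2 he.2))
  -- Before the limit, the operator on `K'` is the partner of `(1 + itT)e`, so the two norms agree.
  have hbound (t : ℝ) : ‖P + (t * Complex.I : ℂ) • T'‖ ^ 2 ≤ 1 + t ^ 2 * ‖T‖ ^ 2 := by
    refine le_trans (pow_le_pow_left₀ (norm_nonneg _) ?_ 2) (hΓ.norm_one_add_smul_sq_le hT t)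
    refine (hP.add (hT'.smul (t * Complex.I : ℂ))).norm_le (norm_nonneg _) ?_
    filter_upwards [hunit] with e he
    have h := hΓ.norm_eq _ (Γ.add_mem he.1 (Γ.smul_mem (t * Complex.I : ℂ) (hf e he.1)))
    refine h.symm.le.trans ?_
    have : (e + (t * Complex.I : ℂ) • (T * e.1, f e)).1 = (1 + (t * Complex.I : ℂ) • T) * e.1 := by
      simp [add_mul]
    rw [this]
    exact (norm_mul_le _ _).trans (mul_le_of_le_one_right (norm_nonneg _) (he1 he.2))
  refine ⟨T', ?_, fun p hp => ⟨?_, (hTmul hp).2⟩⟩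
  · rw [isSelfAdjoint_iff_isSymmetric, LinearMap.isSymmetric_iff_inner_map_self_real]
    intro x
    -- Applying the bound to `P x` and cancelling `‖P x‖²` leaves a quadratic inequality in `t`
    -- whose linear coefficient must vanish.
    have hre : (inner ℂ (P x) (Complex.I • T' (P x))).re = 0 := by
      refine neg_eq_zero.1 (eq_zero_of_forall_quadratic_nonneg
        (b := ‖T‖ ^ 2 * ‖P x‖ ^ 2 - ‖Complex.I • T' (P x)‖ ^ 2) fun t => ?_)
      have h1 := (P + (t * Complex.I : ℂ) • T').le_opNorm (P x)
      have h2 : (P + (t * Complex.I : ℂ) • T') (P x) = P x + (t : ℂ) • Complex.I • T' (P x) := by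
        rw [add_apply, smul_apply, smul_smul, show P (P x) = P x from congr($hPP x)]
      rw [h2] at h1
      have h3 := pow_le_pow_left₀ (norm_nonneg _) h1 2
      rw [norm_add_smul_sq, mul_pow] at h3
      have h4 := mul_le_mul_of_nonneg_right (hbound t) (sq_nonneg ‖P x‖)
      linarith
    have him : (inner ℂ (T' x) x : ℂ) = inner ℂ (T' (P x)) (P x) := by
      have h1 : T' x = P (T' (P x)) := by
        rw [show T' (P x) = T' x from congr($hTP x), show P (T' x) = T' x from congr($hPT x)]
      rw [h1]
      exact (isSelfAdjoint_iff_isSymmetric.1 hPsa) _ _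
    rw [Complex.conj_eq_iff_im]
    change (inner ℂ (T' x) x : ℂ).im = 0
    rw [him, ← inner_conj_symm, Complex.conj_im, neg_eq_zero]
    rw [inner_smul_right] at hre
    simpa using hre
  · rw [(hTmul hp).1]
    exact hf p hp

/-- Two-sided multipliers of the first algebra whose adjoints are multipliers are transported to the
second Hilbert space, compatibly with adjoints. -/
theorem exists_multiplier {T : K →L[ℂ] K}
    (hl : ∀ p ∈ Γ, ∃ y, (T * p.1, y) ∈ Γ) (hr : ∀ p ∈ Γ, ∃ y, (p.1 * T, y) ∈ Γ)
    (hl' : ∀ p ∈ Γ, ∃ y, (star T * p.1, y) ∈ Γ) (hr' : ∀ p ∈ Γ, ∃ y, (p.1 * star T, y) ∈ Γ) :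
    ∃ T' : K' →L[ℂ] K', ∀ p ∈ Γ, ((T * p.1, T' * p.2) ∈ Γ ∧ (p.1 * T, p.2 * T') ∈ Γ) ∧
      (star T * p.1, star T' * p.2) ∈ Γ ∧ (p.1 * star T, p.2 * star T') ∈ Γ := by
  have hcomb {x y z : K →L[ℂ] K} (c d : ℂ) (hz : z = c • x + d • y) (hx : ∃ w, (x, w) ∈ Γ)
      (hy : ∃ w, (y, w) ∈ Γ) : ∃ w, (z, w) ∈ Γ := by
    obtain ⟨a, ha⟩ := hx
    obtain ⟨b, hb⟩ := hy
    rw [hz]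
    exact ⟨_, Γ.add_mem (Γ.smul_mem c ha) (Γ.smul_mem d hb)⟩
  have hI : star Complex.I = -Complex.I := Complex.conj_I
  -- Twice the real and imaginary parts of `T`. Each is a self-adjoint multiplier, which is where
  -- the hypotheses on `star T` enter.
  obtain ⟨X, hX⟩ : ∃ X, X = T + star T := ⟨_, rfl⟩
  obtain ⟨Y, hY⟩ : ∃ Y, Y = (-Complex.I) • T + Complex.I • star T := ⟨_, rfl⟩
  have hT1 : T = (1 / 2 : ℂ) • X + (Complex.I / 2) • Y := by
    rw [hX, hY]
    simp only [smul_add, smul_smul, div_mul_eq_mul_div, mul_neg, Complex.I_mul_I]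
    module
  have hT2 : star T = (1 / 2 : ℂ) • X + (-Complex.I / 2) • Y := by
    rw [hX, hY]
    simp only [smul_add, smul_smul, div_mul_eq_mul_div, mul_neg, neg_mul, Complex.I_mul_I]
    module
  obtain ⟨R, hR, hR'⟩ := hΓ.exists_selfAdjoint_multiplier (T := X)
    (by rw [hX, IsSelfAdjoint, star_add, star_star, add_comm])
    (fun p hp => hcomb 1 1 (by rw [hX, add_mul, one_smul, one_smul]) (hl p hp) (hl' p hp))
    (fun p hp => hcomb 1 1 (by rw [hX, mul_add, one_smul, one_smul]) (hr p hp) (hr' p hp))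
  obtain ⟨J, hJ, hJ'⟩ := hΓ.exists_selfAdjoint_multiplier (T := Y)
    (by rw [hY, IsSelfAdjoint, star_add, star_smul, star_smul, star_star, star_neg, hI, neg_neg,
      add_comm])
    (fun p hp => hcomb (-Complex.I) Complex.I
      (by rw [hY, add_mul, smul_mul_assoc, smul_mul_assoc]) (hl p hp) (hl' p hp))
    (fun p hp => hcomb (-Complex.I) Complex.I
      (by rw [hY, mul_add, mul_smul_comm, mul_smul_comm]) (hr p hp) (hr' p hp))
  clear hX hY
  have hS : star ((1 / 2 : ℂ) • R + (Complex.I / 2) • J) =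
      (1 / 2 : ℂ) • R + (-Complex.I / 2) • J := by
    rw [star_add, star_smul, star_smul, hR.star_eq, hJ.star_eq, star_div₀, star_div₀, hI, star_one,
      star_ofNat]
  have hgen {S : K →L[ℂ] K} {c d : ℂ} (h : S = c • X + d • Y)
      (p : (K →L[ℂ] K) × (K' →L[ℂ] K')) (hp : p ∈ Γ) :
      (S * p.1, (c • R + d • J) * p.2) ∈ Γ ∧ (p.1 * S, p.2 * (c • R + d • J)) ∈ Γ := by
    rw [h]
    simp only [add_mul, mul_add, smul_mul_assoc, mul_smul_comm]
    exact ⟨Γ.add_mem (Γ.smul_mem c (hR' p hp).1) (Γ.smul_mem d (hJ' p hp).1),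
      Γ.add_mem (Γ.smul_mem c (hR' p hp).2) (Γ.smul_mem d (hJ' p hp).2)⟩
  refine ⟨(1 / 2 : ℂ) • R + (Complex.I / 2) • J, fun p hp => ⟨hgen hT1 p hp, ?_⟩⟩
  rw [hS]
  exact hgen hT2 p hp

end IsIsometricGraph

end Multiplier

/-! ### Ternary rings: separable closed ones are σ-TROs -/

section TernaryRings

variable {H : Type*} [NormedAddCommGroup H] [InnerProductSpace ℂ H] [CompleteSpace H]
variable {K : Type*} [NormedAddCommGroup K] [InnerProductSpace ℂ K] [CompleteSpace K]

/-- The space of adjoints of the elements of a subspace of `B(H, K)`. -/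
noncomputable def adjointSubmodule (M : Submodule ℂ (H →L[ℂ] K)) : Submodule ℂ (K →L[ℂ] H) :=
  M.comap (adjoint : (K →L[ℂ] H) ≃ₗᵢ⋆[ℂ] (H →L[ℂ] K)).toLinearEquiv.toLinearMap

@[simp] theorem mem_adjointSubmodule {M : Submodule ℂ (H →L[ℂ] K)} {x : K →L[ℂ] H} :
    x ∈ adjointSubmodule M ↔ adjoint x ∈ M := Iff.rfl

theorem coe_adjointSubmodule_eq_image (M : Submodule ℂ (H →L[ℂ] K)) :
    (adjointSubmodule M : Set (K →L[ℂ] H)) = adjoint '' M := by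
  ext x
  exact ⟨fun h => ⟨_, h, adjoint_adjoint x⟩, fun ⟨y, hy, hyx⟩ => by
    rw [← hyx]; simpa using hy⟩

theorem continuous_adjoint : Continuous (adjoint : (H →L[ℂ] K) → (K →L[ℂ] H)) :=
  (adjoint : (H →L[ℂ] K) ≃ₗᵢ⋆[ℂ] (K →L[ℂ] H)).continuous

theorem isClosed_adjointSubmodule {M : Submodule ℂ (H →L[ℂ] K)}
    (hM : IsClosed (M : Set (H →L[ℂ] K))) :
    IsClosed (adjointSubmodule M : Set (K →L[ℂ] H)) :=
  hM.preimage continuous_adjoint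

/-- The operators on `K` which, together with their adjoints, multiply a subspace of `B(H, K)` into
itself from the left. -/
noncomputable def leftMultiplierStarSubalgebra (X : Submodule ℂ (H →L[ℂ] K)) :
    StarSubalgebra ℂ (K →L[ℂ] K) where
  carrier := {T | (∀ x ∈ X, T ∘L x ∈ X) ∧ ∀ x ∈ X, star T ∘L x ∈ X}
  mul_mem' {a b} ha hb := by
    refine ⟨fun x hx => ?_, fun x hx => ?_⟩
    · rw [mul_def, comp_assoc]
      exact ha.1 _ (hb.1 x hx)
    · rw [star_mul, mul_def, comp_assoc]
      exact hb.2 _ (ha.2 x hx)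
  add_mem' {a b} ha hb := by
    refine ⟨fun x hx => ?_, fun x hx => ?_⟩
    · rw [add_comp]
      exact X.add_mem (ha.1 x hx) (hb.1 x hx)
    · rw [star_add, add_comp]
      exact X.add_mem (ha.2 x hx) (hb.2 x hx)
  algebraMap_mem' c := by
    have h (c : ℂ) (x) (hx : x ∈ X) : (algebraMap ℂ (K →L[ℂ] K) c) ∘L x ∈ X := by
      rw [Algebra.algebraMap_eq_smul_one, smul_comp, one_def, id_comp]
      exact X.smul_mem c hx
    refine ⟨h c, ?_⟩
    rw [← algebraMap_star_comm]
    exact h _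
  star_mem' {a} ha := ⟨ha.2, by rw [star_star]; exact ha.1⟩

/-- The set of left multipliers of a closed subspace of `B(H, K)` whose adjoints are again left
multipliers is closed under the continuous functional calculus. -/
theorem cfc_comp_mem {X : Submodule ℂ (H →L[ℂ] K)} (hX : IsClosed (X : Set (H →L[ℂ] K)))
    {T : K →L[ℂ] K} (hT : IsSelfAdjoint T) (h : ∀ x ∈ X, T ∘L x ∈ X) (f : ℝ → ℝ)
    {x : H →L[ℂ] K} (hx : x ∈ X) : cfc f T ∘L x ∈ X := by
  let S : StarSubalgebra ℂ (K →L[ℂ] K) := leftMultiplierStarSubalgebra X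
  have hS : IsClosed (S : Set (K →L[ℂ] K)) := by
    have : (S : Set (K →L[ℂ] K)) = (⋂ x ∈ X, rightComp x ⁻¹' X) ∩
        ⋂ x ∈ X, (fun T => rightComp x (star T)) ⁻¹' (X : Set (H →L[ℂ] K)) := by
      ext T
      simp only [Set.mem_inter_iff, Set.mem_iInter]
      rfl
    rw [this]
    exact .inter (isClosed_biInter fun x _ => hX.preimage (rightComp x).continuous)
      (isClosed_biInter fun x _ => hX.preimage ((rightComp x).continuous.comp continuous_star))
  have hTS : T ∈ S := ⟨h, by rw [hT.star_eq]; exact h⟩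
  exact (cfc_mem (s := S) f hTS).1 x hx

theorem comp_adjoint_nonneg (x : H →L[ℂ] K) : 0 ≤ x ∘L adjoint x :=
  (nonneg_iff_isPositive _).2 (isPositive_self_comp_adjoint x)

theorem norm_comp_adjoint_self (x : H →L[ℂ] K) : ‖x ∘L adjoint x‖ = ‖x‖ ^ 2 := by
  have := norm_adjoint_comp_self (adjoint x)
  rwa [adjoint_adjoint, LinearIsometryEquiv.norm_map, ← sq] at this

theorem norm_sq_eq_norm_adjoint_comp (x : H →L[ℂ] K) : ‖x‖ ^ 2 = ‖adjoint x ∘L x‖ := by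
  rw [norm_adjoint_comp_self, sq]

theorem norm_le_one_of_nonneg_of_le_one {T : K →L[ℂ] K} (h0 : 0 ≤ T) (h1 : T ≤ 1) : ‖T‖ ≤ 1 :=
  (CStarAlgebra.norm_le_one_iff_of_nonneg T h0).2 h1

theorem sqrt_mul_self_of_nonneg {T : K →L[ℂ] K} (h0 : 0 ≤ T) :
    cfc Real.sqrt T * cfc Real.sqrt T = T := by
  rw [← cfc_mul Real.sqrt Real.sqrt T]
  conv_rhs => rw [← cfc_id ℝ T]
  refine cfc_congr fun t ht => ?_
  simpa using Real.mul_self_sqrt (spectrum_nonneg_of_nonneg h0 ht)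

/-- With `R = √T`, a contraction, `‖Tz‖ ≤ ‖Rz‖` and `‖Rz‖² = ‖z*Tz‖`. Smallness of the monotone
quantity `z*(1 - F)z` thus forces `Fz` to be close to `z`. -/
theorem norm_comp_sq_le {T : K →L[ℂ] K} (h0 : 0 ≤ T) (h1 : T ≤ 1) (z : H →L[ℂ] K) :
    ‖T ∘L z‖ ^ 2 ≤ ‖adjoint z ∘L T ∘L z‖ := by
  set R := cfc Real.sqrt T with hR
  have hRR : R * R = T := sqrt_mul_self_of_nonneg h0
  have hRs : adjoint R = R := (cfc_predicate Real.sqrt T : IsSelfAdjoint R)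
  have hRn : ‖R‖ ^ 2 ≤ 1 := by
    rw [norm_sq_eq_norm_adjoint_comp, hRs]
    exact (congrArg norm hRR).le.trans (norm_le_one_of_nonneg_of_le_one h0 h1)
  have hRz : ‖R ∘L z‖ ^ 2 = ‖adjoint z ∘L T ∘L z‖ := by
    rw [norm_sq_eq_norm_adjoint_comp, adjoint_comp, hRs, comp_assoc, ← comp_assoc R R z]
    exact congrArg (fun S => ‖adjoint z ∘L S ∘L z‖) hRR
  rw [← hRz, ← hRR, show (R * R) ∘L z = R ∘L (R ∘L z) from rfl]
  calc _ ≤ (‖R‖ * ‖R ∘L z‖) ^ 2 := pow_le_pow_left₀ (norm_nonneg _) (opNorm_comp_le _ _) 2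
    _ = ‖R‖ ^ 2 * ‖R ∘L z‖ ^ 2 := mul_pow _ _ _
    _ ≤ _ := mul_le_of_le_one_left (by positivity) hRn

/-- `(h + δ)^(-1/2)` for a positive operator `h` on `K`. -/
theorem exists_inv_sqrt {X : Submodule ℂ (H →L[ℂ] K)} (hX : IsClosed (X : Set (H →L[ℂ] K)))
    {h : K →L[ℂ] K} (h0 : 0 ≤ h) (hh : ∀ x ∈ X, h ∘L x ∈ X) {δ : ℝ} (hδ : 0 < δ) :
    ∃ u : K →L[ℂ] K, adjoint u = u ∧ u * h * u = 1 - (δ : ℂ) • (u * u) ∧ ∀ x ∈ X, u ∘L x ∈ X := by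
  have hsa : IsSelfAdjoint h := .of_nonneg h0
  have hpos {t : ℝ} (ht : t ∈ spectrum ℝ h) : 0 < t + δ :=
    add_pos_of_nonneg_of_pos (spectrum_nonneg_of_nonneg h0 ht) hδ
  have hcont : ContinuousOn (fun t : ℝ => (√(t + δ))⁻¹) (spectrum ℝ h) :=
    ContinuousOn.inv₀ (by fun_prop) fun t ht => (Real.sqrt_pos.2 (hpos ht)).ne'
  refine ⟨cfc (fun t : ℝ => (√(t + δ))⁻¹) h, (cfc_predicate _ h : IsSelfAdjoint _), ?_,
    fun x hx => cfc_comp_mem hX hsa hh _ hx⟩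
  set u := cfc (fun t : ℝ => (√(t + δ))⁻¹) h with hu
  have h1 : u * h * u = cfc (fun t : ℝ => (√(t + δ))⁻¹ * t * (√(t + δ))⁻¹) h := by
    rw [cfc_mul (fun t : ℝ => (√(t + δ))⁻¹ * t) _ h (hcont.mul continuousOn_id) hcont,
      cfc_mul _ (fun t : ℝ => t) h hcont continuousOn_id, cfc_id' ℝ h]
  have h2 : (δ : ℂ) • (u * u) = cfc (fun t : ℝ => δ * ((√(t + δ))⁻¹ * (√(t + δ))⁻¹)) h := by
    rw [cfc_const_mul δ (fun t : ℝ => (√(t + δ))⁻¹ * (√(t + δ))⁻¹) h (hcont.mul hcont),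
      cfc_mul _ _ h hcont hcont]
    exact Complex.coe_smul δ (u * u)
  rw [eq_sub_iff_add_eq, h1, h2, ← cfc_add h (fun t : ℝ => (√(t + δ))⁻¹ * t * (√(t + δ))⁻¹)
    (fun t : ℝ => δ * ((√(t + δ))⁻¹ * (√(t + δ))⁻¹)) ((hcont.mul continuousOn_id).mul hcont)
    (continuousOn_const.mul (hcont.mul hcont)), ← cfc_one ℝ h]
  -- On the spectrum the identity reads `t/(t + δ) + δ/(t + δ) = 1`.
  refine cfc_congr fun t ht => ?_
  have h3 := hpos ht
  have h4 : (√(t + δ))⁻¹ * (√(t + δ))⁻¹ = (t + δ)⁻¹ := by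
    rw [← mul_inv, Real.mul_self_sqrt h3.le]
  calc _ = ((√(t + δ))⁻¹ * (√(t + δ))⁻¹) * (t + δ) := by ring
    _ = 1 := by rw [h4, inv_mul_cancel₀ h3.ne']

/-- Take `R = √(1 - F)`, `w = Rz`, `u = (ww* + δ)^(-1/2)` and `x = Ruw`. Then `1 - F - xx* = R(1 -
uww*u)R = δ R u² R ≥ 0`. Compressing by `z` gives `δ (uw)*(uw)`, of norm at most `δ` because `uww*u
≤ 1`. -/
theorem exists_enlarge_sum {X : Submodule ℂ (H →L[ℂ] K)} (hX : IsClosed (X : Set (H →L[ℂ] K)))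
    (htriple : ∀ x ∈ X, ∀ y ∈ X, ∀ z ∈ X, x ∘L adjoint y ∘L z ∈ X) {F : K →L[ℂ] K}
    (h1 : F ≤ 1) (hF : ∀ x ∈ X, F ∘L x ∈ X) {z : H →L[ℂ] K} (hz : z ∈ X) {δ : ℝ}
    (hδ : 0 < δ) :
    ∃ x ∈ X, F + x ∘L adjoint x ≤ 1 ∧
      ‖adjoint z ∘L (1 - (F + x ∘L adjoint x)) ∘L z‖ ≤ δ := by
  have hF1 : 0 ≤ 1 - F := sub_nonneg.2 h1
  have hF1X (x) (hx : x ∈ X) : (1 - F) ∘L x ∈ X := by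
    rw [sub_comp, one_def, id_comp]
    exact X.sub_mem hx (hF x hx)
  set R := cfc Real.sqrt (1 - F) with hR
  have hRR : R * R = 1 - F := sqrt_mul_self_of_nonneg hF1
  have hRs : adjoint R = R := (cfc_predicate Real.sqrt (1 - F) : IsSelfAdjoint R)
  have hRX (x) (hx : x ∈ X) : R ∘L x ∈ X := cfc_comp_mem hX (.of_nonneg hF1) hF1X _ hx
  set w := R ∘L z with hw
  have hwX : w ∈ X := hRX z hz
  obtain ⟨u, hus, huhu, huX⟩ := exists_inv_sqrt hX (comp_adjoint_nonneg w)
    (fun x hx => by rw [comp_assoc]; exact htriple w hwX w hwX x hx) hδ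
  have hus' : star u = u := hus
  have hRs' : star R = R := hRs
  have hxx : (R ∘L u ∘L w) ∘L adjoint (R ∘L u ∘L w) = R * (u * (w ∘L adjoint w) * u) * R := by
    simp only [adjoint_comp, hus, hRs, mul_def, comp_assoc]
  have hdiff : 1 - (F + (R ∘L u ∘L w) ∘L adjoint (R ∘L u ∘L w)) = (δ : ℂ) • (R * (u * u) * R) := by
    rw [hxx, huhu, ← sub_sub, ← hRR, mul_sub, sub_mul, mul_one, sub_sub_cancel, mul_smul_comm,
      smul_mul_assoc]
  have hpos (v : K →L[ℂ] K) : 0 ≤ (δ : ℂ) • (star v * v) := by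
    rw [Complex.coe_smul]
    exact smul_nonneg hδ.le (star_mul_self_nonneg v)
  refine ⟨R ∘L u ∘L w, hRX _ (huX _ hwX), ?_, ?_⟩
  · rw [← sub_nonneg, hdiff]
    have := hpos (u * R)
    rwa [star_mul, hus', hRs', ← mul_assoc, mul_assoc R u u] at this
  · rw [hdiff]
    have h3 : adjoint z ∘L ((δ : ℂ) • (R * (u * u) * R)) ∘L z
        = (δ : ℂ) • (adjoint (u ∘L w) ∘L (u ∘L w)) := by
      simp only [adjoint_comp, hus, hRs, hw, mul_def, comp_assoc, smul_comp, comp_smul]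
    have h4 : ‖u ∘L w‖ ^ 2 ≤ 1 := by
      rw [← norm_comp_adjoint_self]
      refine norm_le_one_of_nonneg_of_le_one (comp_adjoint_nonneg _) ?_
      have : (u ∘L w) ∘L adjoint (u ∘L w) = u * (w ∘L adjoint w) * u := by
        simp only [adjoint_comp, hus, mul_def, comp_assoc]
      rw [this, huhu, sub_le_self_iff]
      have := hpos u
      rwa [hus'] at this
    rw [h3, norm_smul, ← norm_sq_eq_norm_adjoint_comp, Complex.norm_real,
      Real.norm_of_nonneg hδ.le]
    exact mul_le_of_le_one_right hδ.le h4

/-- A separable closed TRO has a countable left approximate unit of sums `∑ mᵢ mᵢ*`. -/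
theorem exists_left_of_isSeparable {X : Submodule ℂ (H →L[ℂ] K)}
    (hX : IsClosed (X : Set (H →L[ℂ] K)))
    (htriple : ∀ x ∈ X, ∀ y ∈ X, ∀ z ∈ X, x ∘L adjoint y ∘L z ∈ X)
    (hsep : TopologicalSpace.IsSeparable (X : Set (H →L[ℂ] K))) :
    ∃ m : ℕ → (H →L[ℂ] K), (∀ i, m i ∈ X) ∧
    (∀ x ∈ X, Tendsto (fun l : ℕ => ∑ i ∈ Finset.range l, m i ∘L adjoint (m i) ∘L x)
      atTop (𝓝 x)) ∧
    ∀ l : ℕ, ‖∑ i ∈ Finset.range l, m i ∘L adjoint (m i)‖ ≤ 1 := by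
  obtain ⟨c, hcX, hc, hXc⟩ := hsep.exists_countable_dense_subset
  have hne : c.Nonempty := closure_nonempty_iff.1 ⟨0, hXc X.zero_mem⟩
  obtain ⟨d, rfl⟩ := hc.exists_eq_range hne
  have hdX (k : ℕ) : d k ∈ X := hcX ⟨k, rfl⟩
  let S := {F : K →L[ℂ] K // 0 ≤ F ∧ F ≤ 1 ∧ ∀ x ∈ X, F ∘L x ∈ X}
  -- Step `l` improves the sum at the dense element with index `l.unpair.1`, with tolerance `1/(l +
  -- 1)`. Unpairing returns to every dense element infinitely often.
  have step (F : S) (l : ℕ) := exists_enlarge_sum hX htriple F.2.2.1 F.2.2.2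
    (hdX l.unpair.1) (Nat.one_div_pos_of_nat (α := ℝ) (n := l))
  choose e heX he1 he2 using step
  let next (F : S) (l : ℕ) : S := ⟨F.1 + e F l ∘L adjoint (e F l),
    add_nonneg F.2.1 (comp_adjoint_nonneg _), he1 F l, fun x hx => by
      rw [add_comp, comp_assoc]
      exact X.add_mem (F.2.2.2 x hx) (htriple _ (heX F l) _ (heX F l) x hx)⟩
  let G : ℕ → S := fun l => Nat.rec ⟨0, le_rfl, zero_le_one, fun x _ => by
    rw [zero_comp]; exact X.zero_mem⟩ (fun l F => next F l) l
  have hG (l : ℕ) : ∑ i ∈ Finset.range l, e (G i) i ∘L adjoint (e (G i) i) = (G l).1 := by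
    induction l with
    | zero => rfl
    | succ l ih => rw [Finset.sum_range_succ, ih]
  have hGmono : Monotone fun l => (G l).1 :=
    monotone_nat_of_le_succ fun l => le_add_of_nonneg_right (comp_adjoint_nonneg _)
  have hnorm (l : ℕ) : ‖(G l).1‖ ≤ 1 := norm_le_one_of_nonneg_of_le_one (G l).2.1 (G l).2.2.1
  refine ⟨fun l => e (G l) l, fun l => heX _ _, fun x hx => ?_, fun l => ?_⟩
  · simp only [← comp_assoc, ← sum_comp, hG]
    refine tendsto_self_of_mem_closure (f := fun l x => (G l).1 ∘L x) (c := 1)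
      (Eventually.of_forall fun l x y => ?_) ?_ (hXc hx)
    · rw [← comp_sub]
      exact (opNorm_comp_le _ _).trans (by gcongr; exact hnorm l)
    · rintro _ ⟨k, rfl⟩
      rw [Metric.tendsto_atTop]
      intro ε hε
      obtain ⟨n, hn⟩ := exists_nat_one_div_lt (show 0 < ε ^ 2 by positivity)
      -- Step `Nat.pair k n` serves `d k`, and its summand enters the partial sums one index later.
      -- From there on the defect at `d k` can only decrease, and `n ≤ Nat.pair k n`.
      refine ⟨Nat.pair k n + 1, fun l hl => ?_⟩
      rw [dist_comm, dist_eq_norm]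
      refine lt_of_pow_lt_pow_left₀ 2 hε.le ?_
      have h1 : d k - (G l).1 ∘L d k = (1 - (G l).1) ∘L d k := by
        simp only [sub_comp, one_def, id_comp]
      have h2 : ‖adjoint (d k) ∘L (1 - (G (Nat.pair k n + 1)).1) ∘L d k‖
          ≤ 1 / ((Nat.pair k n : ℝ) + 1) := by
        have := he2 (G (Nat.pair k n)) (Nat.pair k n)
        rwa [Nat.unpair_pair] at this
      have h3 : adjoint (d k) ∘L (1 - (G l).1) ∘L d k ≤
          adjoint (d k) ∘L (1 - (G (Nat.pair k n + 1)).1) ∘L d k := by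
        rw [← sub_nonneg, ← comp_sub, ← sub_comp, sub_sub_sub_cancel_left, nonneg_iff_isPositive]
        exact ((nonneg_iff_isPositive _).1 (sub_nonneg.2 (hGmono hl))).adjoint_conj (d k)
      have h4 : 0 ≤ adjoint (d k) ∘L (1 - (G l).1) ∘L d k := by
        rw [nonneg_iff_isPositive]
        exact ((nonneg_iff_isPositive _).1 (sub_nonneg.2 (G l).2.2.1)).adjoint_conj (d k)
      rw [h1]
      calc _ ≤ _ := norm_comp_sq_le (sub_nonneg.2 (G l).2.2.1) (sub_le_self _ (G l).2.1) _
        _ ≤ _ := CStarAlgebra.norm_le_norm_of_nonneg_of_le h4 h3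
        _ ≤ 1 / ((Nat.pair k n : ℝ) + 1) := h2
        _ ≤ 1 / ((n : ℝ) + 1) := by
          gcongr
          exact Nat.right_le_pair k n
        _ < _ := hn
  · rw [hG]
    exact hnorm l

theorem adjointSubmodule_triple_mem {X : Submodule ℂ (H →L[ℂ] K)}
    (htriple : ∀ x ∈ X, ∀ y ∈ X, ∀ z ∈ X, x ∘L adjoint y ∘L z ∈ X) :
    ∀ x ∈ adjointSubmodule X, ∀ y ∈ adjointSubmodule X, ∀ z ∈ adjointSubmodule X,
      x ∘L adjoint y ∘L z ∈ adjointSubmodule X := by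
  intro x hx y hy z hz
  rw [mem_adjointSubmodule, adjoint_comp, adjoint_comp, comp_assoc]
  exact htriple _ hz _ hy _ hx

/-- Adjoints turn left approximate units of a TRO into right ones of the adjoint TRO. -/
theorem exists_right_of_adjoint {X : Submodule ℂ (H →L[ℂ] K)}
    (h : ∃ m : ℕ → (K →L[ℂ] H), (∀ i, m i ∈ adjointSubmodule X) ∧
      (∀ x ∈ adjointSubmodule X,
        Tendsto (fun l : ℕ => ∑ i ∈ Finset.range l, m i ∘L adjoint (m i) ∘L x) atTop (𝓝 x)) ∧
      ∀ l : ℕ, ‖∑ i ∈ Finset.range l, m i ∘L adjoint (m i)‖ ≤ 1) :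
    ∃ n : ℕ → (H →L[ℂ] K), (∀ i, n i ∈ X) ∧
      (∀ x ∈ X, Tendsto (fun l : ℕ => ∑ i ∈ Finset.range l, x ∘L adjoint (n i) ∘L n i)
        atTop (𝓝 x)) ∧
      ∀ l : ℕ, ‖∑ i ∈ Finset.range l, adjoint (n i) ∘L n i‖ ≤ 1 := by
  obtain ⟨m, hm, hlim, hn⟩ := h
  refine ⟨fun i => adjoint (m i), hm, fun x hx => ?_, fun l => ?_⟩
  · have := (continuous_adjoint.tendsto _).comp (hlim (adjoint x) (by simpa using hx))
    simpa [Function.comp_def, adjoint_comp, comp_assoc] using this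
  · simpa using hn l

theorem exists_left_of_adjoint {X : Submodule ℂ (H →L[ℂ] K)}
    (h : ∃ n : ℕ → (K →L[ℂ] H), (∀ i, n i ∈ adjointSubmodule X) ∧
      (∀ x ∈ adjointSubmodule X,
        Tendsto (fun l : ℕ => ∑ i ∈ Finset.range l, x ∘L adjoint (n i) ∘L n i) atTop (𝓝 x)) ∧
      ∀ l : ℕ, ‖∑ i ∈ Finset.range l, adjoint (n i) ∘L n i‖ ≤ 1) :
    ∃ m : ℕ → (H →L[ℂ] K), (∀ i, m i ∈ X) ∧
      (∀ x ∈ X, Tendsto (fun l : ℕ => ∑ i ∈ Finset.range l, m i ∘L adjoint (m i) ∘L x)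
        atTop (𝓝 x)) ∧
      ∀ l : ℕ, ‖∑ i ∈ Finset.range l, m i ∘L adjoint (m i)‖ ≤ 1 := by
  obtain ⟨n, hn, hlim, hnorm⟩ := h
  refine ⟨fun i => adjoint (n i), hn, fun x hx => ?_, fun l => ?_⟩
  · have := (continuous_adjoint.tendsto _).comp (hlim (adjoint x) (by simpa using hx))
    simpa [Function.comp_def, adjoint_comp, comp_assoc] using this
  · simpa using hnorm l

/-- A separable closed TRO is a σ-TRO. -/
theorem isSigmaTRO_of_isSeparable {X : Submodule ℂ (H →L[ℂ] K)}
    (hX : IsClosed (X : Set (H →L[ℂ] K)))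
    (htriple : ∀ x ∈ X, ∀ y ∈ X, ∀ z ∈ X, x ∘L adjoint y ∘L z ∈ X)
    (hsep : TopologicalSpace.IsSeparable (X : Set (H →L[ℂ] K))) : IsSigmaTRO X where
  isClosed := hX
  triple_mem := htriple
  exists_left := exists_left_of_isSeparable hX htriple hsep
  exists_right := exists_right_of_adjoint <| exists_left_of_isSeparable
    (isClosed_adjointSubmodule hX) (adjointSubmodule_triple_mem htriple) <| by
      rw [coe_adjointSubmodule_eq_image]
      exact hsep.image continuous_adjoint

theorem IsSigmaTRO.conjugate {X : Submodule ℂ (H →L[ℂ] K)} (hX : IsSigmaTRO X) :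
    IsSigmaTRO (adjointSubmodule X) where
  isClosed := isClosed_adjointSubmodule hX.isClosed
  triple_mem := adjointSubmodule_triple_mem hX.triple_mem
  exists_left := exists_left_of_adjoint <| by
    have : adjointSubmodule (adjointSubmodule X) = X := by ext; simp
    rw [this]
    exact hX.exists_right
  exists_right := exists_right_of_adjoint <| by
    have : adjointSubmodule (adjointSubmodule X) = X := by ext; simp
    rw [this]
    exact hX.exists_left

theorem continuous_triple : Continuous fun p : (H →L[ℂ] K) × (H →L[ℂ] K) × (H →L[ℂ] K) =>
    p.1 ∘L adjoint p.2.1 ∘L p.2.2 :=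
  continuous_fst.clm_comp ((continuous_adjoint.comp continuous_snd.fst).clm_comp continuous_snd.snd)

/-- Every countable subset of a closed TRO is contained in a σ-TRO inside it. -/
theorem exists_isSigmaTRO_between {U : Submodule ℂ (H →L[ℂ] K)}
    (hU : IsClosed (U : Set (H →L[ℂ] K)))
    (htriple : ∀ x ∈ U, ∀ y ∈ U, ∀ z ∈ U, x ∘L adjoint y ∘L z ∈ U) {s : Set (H →L[ℂ] K)}
    (hs : s.Countable) (hsU : s ⊆ U) :
    ∃ X : Submodule ℂ (H →L[ℂ] K), IsSigmaTRO X ∧ s ⊆ X ∧ X ≤ U := by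
  let t : (H →L[ℂ] K) × (H →L[ℂ] K) × (H →L[ℂ] K) → (H →L[ℂ] K) :=
    fun p => p.1 ∘L adjoint p.2.1 ∘L p.2.2
  let next (V : Submodule ℂ (H →L[ℂ] K)) : Submodule ℂ (H →L[ℂ] K) :=
    Submodule.span ℂ
      (V ∪ t '' ((V : Set (H →L[ℂ] K)) ×ˢ (V : Set (H →L[ℂ] K)) ×ˢ (V : Set (H →L[ℂ] K))))
  -- Each stage adjoins the triple products of the previous one, so all stages are separable and
  -- their union is closed under triple products.
  let W : ℕ → Submodule ℂ (H →L[ℂ] K) := fun n => Nat.rec (Submodule.span ℂ s) (fun _ V => next V) n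
  have hle (n : ℕ) : W n ≤ W (n + 1) := fun _ hx => Submodule.subset_span (Or.inl hx)
  have hmono : Monotone W := monotone_nat_of_le_succ hle
  have htW (n : ℕ) {x y z} (hx : x ∈ W n) (hy : y ∈ W n) (hz : z ∈ W n) :
      x ∘L adjoint y ∘L z ∈ W (n + 1) :=
    Submodule.subset_span (Or.inr ⟨(x, y, z), ⟨hx, hy, hz⟩, rfl⟩)
  have hWU (n : ℕ) : W n ≤ U := by
    induction n with
    | zero => exact Submodule.span_le.2 hsU
    | succ n ih =>
      refine Submodule.span_le.2 (Set.union_subset ih ?_)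
      rintro _ ⟨⟨x, y, z⟩, ⟨hx, hy, hz⟩, rfl⟩
      exact htriple _ (ih hx) _ (ih hy) _ (ih hz)
  have hWsep (n : ℕ) : TopologicalSpace.IsSeparable (SetLike.coe (W n)) := by
    induction n with
    | zero => exact hs.isSeparable.span
    | succ n ih => exact (ih.union ((ih.prod (ih.prod ih)).image continuous_triple)).span
  have hcoe : ((⨆ n, W n : Submodule ℂ (H →L[ℂ] K)) : Set (H →L[ℂ] K)) = ⋃ n, SetLike.coe (W n) :=
    Submodule.coe_iSup_of_directed W hmono.directed_le
  refine ⟨(⨆ n, W n).topologicalClosure, isSigmaTRO_of_isSeparable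
    (Submodule.isClosed_topologicalClosure _) ?_ ?_, ?_, ?_⟩
  · intro x hx y hy z hz
    rw [← SetLike.mem_coe, Submodule.topologicalClosure_coe, hcoe] at hx hy hz ⊢
    have hmem : (x, y, z) ∈ closure ((⋃ n, SetLike.coe (W n)) ×ˢ
        (⋃ n, SetLike.coe (W n)) ×ˢ (⋃ n, SetLike.coe (W n))) := by
      rw [closure_prod_eq, closure_prod_eq]
      exact ⟨hx, hy, hz⟩
    refine map_mem_closure (f := t) continuous_triple hmem ?_
    rintro ⟨a, b, c⟩ ⟨ha, hb, hc⟩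
    obtain ⟨i, hi⟩ := Set.mem_iUnion.1 ha
    obtain ⟨j, hj⟩ := Set.mem_iUnion.1 hb
    obtain ⟨k, hk⟩ := Set.mem_iUnion.1 hc
    exact Set.mem_iUnion.2 ⟨max i (max j k) + 1, htW _ (hmono (le_max_left _ _) hi)
      (hmono ((le_max_left _ _).trans (le_max_right _ _)) hj)
      (hmono ((le_max_right _ _).trans (le_max_right _ _)) hk)⟩
  · rw [Submodule.topologicalClosure_coe, hcoe]
    exact (TopologicalSpace.IsSeparable.iUnion hWsep).closure
  · exact fun x hx => Submodule.le_topologicalClosure _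
      (Submodule.mem_iSup_of_mem 0 (Submodule.subset_span hx))
  · exact Submodule.topologicalClosure_minimal _ (iSup_le hWU) hU

end TernaryRings

/-! ### Links, their composition, and their relation to σ-TROs -/

section Links

variable {H : Type*} [NormedAddCommGroup H] [InnerProductSpace ℂ H] [CompleteSpace H]
variable {K : Type*} [NormedAddCommGroup K] [InnerProductSpace ℂ K] [CompleteSpace K]
variable {L : Type*} [NormedAddCommGroup L] [InnerProductSpace ℂ L] [CompleteSpace L]

theorem tendsto_self_of_mem_closure_span {ι E : Type*} [NormedAddCommGroup E] [NormedSpace ℂ E]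
    {l : Filter ι} {f : ι → E →L[ℂ] E} {c : ℝ} (hf : ∀ᶠ i in l, ‖f i‖ ≤ c) {s : Set E}
    (hs : ∀ x ∈ s, Tendsto (fun i => f i x) l (𝓝 x)) {x : E}
    (hx : x ∈ closure (Submodule.span ℂ s : Set E)) : Tendsto (fun i => f i x) l (𝓝 x) := by
  refine tendsto_self_of_mem_closure (f := fun i x => f i x) (c := c) ?_ (fun x hx => ?_) hx
  · filter_upwards [hf] with i hi x y
    rw [← map_sub]
    exact (f i).le_of_opNorm_le hi _
  · induction hx using Submodule.span_induction with
    | mem x hx => exact hs x hx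
    | zero => simpa using tendsto_const_nhds
    | add x y _ _ hx hy => simpa using hx.add hy
    | smul a x _ hx => simpa using hx.const_smul a

theorem norm_leftComp_le {E F G : Type*} [NormedAddCommGroup E] [NormedSpace ℂ E]
    [NormedAddCommGroup F] [NormedSpace ℂ F] [NormedAddCommGroup G] [NormedSpace ℂ G]
    (a : F →L[ℂ] G) : ‖(leftComp a : (E →L[ℂ] F) →L[ℂ] (E →L[ℂ] G))‖ ≤ ‖a‖ :=
  opNorm_le_bound _ (norm_nonneg _) fun x => opNorm_comp_le a x

theorem norm_rightComp_le {E F G : Type*} [NormedAddCommGroup E] [NormedSpace ℂ E]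
    [NormedAddCommGroup F] [NormedSpace ℂ F] [NormedAddCommGroup G] [NormedSpace ℂ G]
    (a : E →L[ℂ] F) : ‖(rightComp a : (F →L[ℂ] G) →L[ℂ] (E →L[ℂ] G))‖ ≤ ‖a‖ :=
  opNorm_le_bound _ (norm_nonneg _) fun x => (opNorm_comp_le x a).trans_eq (mul_comm _ _)

/-- The products `m₁* b m₂` with `m₁, m₂ ∈ s` and `b ∈ B`. -/
def innerProducts (s : Set (H →L[ℂ] K)) (B : Set (K →L[ℂ] K)) : Set (H →L[ℂ] H) :=
  {x | ∃ m₁ ∈ s, ∃ b ∈ B, ∃ m₂ ∈ s, x = adjoint m₁ ∘L b ∘L m₂}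

/-- The products `m₁ a m₂*` with `m₁, m₂ ∈ s` and `a ∈ A`. -/
def outerProducts (s : Set (H →L[ℂ] K)) (A : Set (H →L[ℂ] H)) : Set (K →L[ℂ] K) :=
  {y | ∃ m₁ ∈ s, ∃ a ∈ A, ∃ m₂ ∈ s, y = m₁ ∘L a ∘L adjoint m₂}

theorem outerProducts_eq_innerProducts (s : Set (H →L[ℂ] K)) (A : Set (H →L[ℂ] H)) :
    outerProducts s A = innerProducts (adjoint '' s) A := by
  ext y
  simp [outerProducts, innerProducts]

theorem innerProducts_mono {s t : Set (H →L[ℂ] K)} (h : s ⊆ t) (B : Set (K →L[ℂ] K)) :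
    innerProducts s B ⊆ innerProducts t B := by
  rintro _ ⟨m₁, h₁, b, hb, m₂, h₂, rfl⟩
  exact ⟨m₁, h h₁, b, hb, m₂, h h₂, rfl⟩

theorem outerProducts_mono {s t : Set (H →L[ℂ] K)} (h : s ⊆ t) (A : Set (H →L[ℂ] H)) :
    outerProducts s A ⊆ outerProducts t A := by
  rintro _ ⟨m₁, h₁, a, ha, m₂, h₂, rfl⟩
  exact ⟨m₁, h h₁, a, ha, m₂, h h₂, rfl⟩

/-- A countable family `s ⊆ B(H, K)` linking the closed spaces `A` and `B` of operators through a
closed space `Y ⊆ B(H, K)`. -/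
structure IsLink (A : Submodule ℂ (H →L[ℂ] H)) (B : Submodule ℂ (K →L[ℂ] K))
    (Y : Submodule ℂ (H →L[ℂ] K)) (s : Set (H →L[ℂ] K)) : Prop where
  countable : s.Countable
  isClosed_left : IsClosed (A : Set (H →L[ℂ] H))
  isClosed_right : IsClosed (B : Set (K →L[ℂ] K))
  isClosed_link : IsClosed (Y : Set (H →L[ℂ] K))
  comp_mem : ∀ m ∈ s, ∀ a ∈ A, m ∘L a ∈ Y
  adjoint_comp_mem : ∀ m ∈ s, ∀ y ∈ Y, adjoint m ∘L y ∈ A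
  comp_adjoint_mem : ∀ m ∈ s, ∀ y ∈ Y, y ∘L adjoint m ∈ B
  mem_comp : ∀ m ∈ s, ∀ b ∈ B, b ∘L m ∈ Y
  left_subset : (A : Set (H →L[ℂ] H)) ⊆
    closure (Submodule.span ℂ (innerProducts s B) : Set (H →L[ℂ] H))
  right_subset : (B : Set (K →L[ℂ] K)) ⊆
    closure (Submodule.span ℂ (outerProducts s A) : Set (K →L[ℂ] K))

namespace IsLink

/-- The closed TRO of all operators which satisfy the algebraic conditions on the members of a
link. -/
def linkers (A : Submodule ℂ (H →L[ℂ] H)) (B : Submodule ℂ (K →L[ℂ] K))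
    (Y : Submodule ℂ (H →L[ℂ] K)) : Submodule ℂ (H →L[ℂ] K) where
  carrier := {x | (∀ a ∈ A, x ∘L a ∈ Y) ∧ (∀ y ∈ Y, adjoint x ∘L y ∈ A) ∧
    (∀ y ∈ Y, y ∘L adjoint x ∈ B) ∧ ∀ b ∈ B, b ∘L x ∈ Y}
  zero_mem' := by simp
  add_mem' := by
    rintro x x' ⟨h1, h2, h3, h4⟩ ⟨h1', h2', h3', h4'⟩
    refine ⟨fun a ha => ?_, fun y hy => ?_, fun y hy => ?_, fun b hb => ?_⟩
    · rw [add_comp]; exact Y.add_mem (h1 a ha) (h1' a ha)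
    · rw [map_add, add_comp]; exact A.add_mem (h2 y hy) (h2' y hy)
    · rw [map_add, comp_add]; exact B.add_mem (h3 y hy) (h3' y hy)
    · rw [comp_add]; exact Y.add_mem (h4 b hb) (h4' b hb)
  smul_mem' := by
    rintro c x ⟨h1, h2, h3, h4⟩
    refine ⟨fun a ha => ?_, fun y hy => ?_, fun y hy => ?_, fun b hb => ?_⟩
    · rw [smul_comp]; exact Y.smul_mem _ (h1 a ha)
    · rw [map_smulₛₗ, smul_comp]; exact A.smul_mem _ (h2 y hy)
    · rw [map_smulₛₗ, comp_smul]; exact B.smul_mem _ (h3 y hy)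
    · rw [comp_smul]; exact Y.smul_mem _ (h4 b hb)

variable {A : Submodule ℂ (H →L[ℂ] H)} {B : Submodule ℂ (K →L[ℂ] K)}
  {Y : Submodule ℂ (H →L[ℂ] K)} {s : Set (H →L[ℂ] K)}

theorem isClosed_linkers (hA : IsClosed (A : Set (H →L[ℂ] H))) (hB : IsClosed (B : Set (K →L[ℂ] K)))
    (hY : IsClosed (Y : Set (H →L[ℂ] K))) :
    IsClosed (linkers A B Y : Set (H →L[ℂ] K)) := by
  have : (linkers A B Y : Set (H →L[ℂ] K)) =
      (⋂ a ∈ A, rightComp a ⁻¹' (Y : Set (H →L[ℂ] K))) ∩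
      ((⋂ y ∈ Y, (fun x => rightComp y (adjoint x)) ⁻¹' (A : Set (H →L[ℂ] H))) ∩
      ((⋂ y ∈ Y, (fun x => leftComp y (adjoint x)) ⁻¹' (B : Set (K →L[ℂ] K))) ∩
      (⋂ b ∈ B, leftComp b ⁻¹' (Y : Set (H →L[ℂ] K))))) := by
    ext x
    simp only [Set.mem_inter_iff, Set.mem_iInter]
    rfl
  rw [this]
  exact (isClosed_biInter fun a _ => hY.preimage (rightComp a).continuous).inter <|
    (isClosed_biInter fun y _ =>
      hA.preimage ((rightComp y).continuous.comp continuous_adjoint)).inter <|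
    (isClosed_biInter fun y _ =>
      hB.preimage ((leftComp y).continuous.comp continuous_adjoint)).inter <|
    isClosed_biInter fun b _ => hY.preimage (leftComp b).continuous

/-- The four conditions make a linker and its adjoint shuttle between an algebra and `Y`, so each
condition for `xy*z` is a chain of three; for instance `z`, `y*`, `x` lead from `A` to `Y`, to `A`,
to `Y`. -/
theorem triple_mem_linkers :
    ∀ x ∈ linkers A B Y, ∀ y ∈ linkers A B Y, ∀ z ∈ linkers A B Y,
      x ∘L adjoint y ∘L z ∈ linkers A B Y := by
  rintro x ⟨hx1, hx2, hx3, hx4⟩ y ⟨hy1, hy2, hy3, hy4⟩ z ⟨hz1, hz2, hz3, hz4⟩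
  refine ⟨fun a ha => ?_, fun w hw => ?_, fun w hw => ?_, fun b hb => ?_⟩
  · exact hx1 _ (hy2 _ (hz1 a ha))
  · rw [adjoint_comp, adjoint_comp, adjoint_adjoint]
    exact hz2 _ (hy1 _ (hx2 w hw))
  · rw [adjoint_comp, adjoint_comp, adjoint_adjoint]
    exact hx3 _ (hy4 _ (hz3 w hw))
  · exact hz4 _ (hy3 _ (hx4 b hb))

/-- Choose a σ-TRO between `s` and the space of all linkers. Containing `s` makes its products dense
in the algebras; consisting of linkers keeps those products inside. -/
theorem sigmaTROEquiv {A : NonUnitalSubalgebra ℂ (H →L[ℂ] H)}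
    {B : NonUnitalSubalgebra ℂ (K →L[ℂ] K)} (h : IsLink A.toSubmodule B.toSubmodule Y s) :
    SigmaTROEquiv A B := by
  obtain ⟨X, hX, hsX, hXU⟩ := exists_isSigmaTRO_between
    (isClosed_linkers h.isClosed_left h.isClosed_right h.isClosed_link) triple_mem_linkers
    h.countable (fun m hm => ⟨h.comp_mem m hm, h.adjoint_comp_mem m hm, h.comp_adjoint_mem m hm,
      h.mem_comp m hm⟩)
  refine ⟨X, hX, subset_antisymm ?_ ?_, subset_antisymm ?_ ?_⟩
  · exact h.left_subset.trans (closure_mono (Submodule.span_mono (innerProducts_mono hsX _)))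
  · refine Submodule.closure_span_subset h.isClosed_left ?_
    rintro _ ⟨m₁, h₁, b, hb, m₂, h₂, rfl⟩
    exact (hXU h₁).2.1 _ ((hXU h₂).2.2.2 b hb)
  · exact h.right_subset.trans (closure_mono (Submodule.span_mono (outerProducts_mono hsX _)))
  · refine Submodule.closure_span_subset h.isClosed_right ?_
    rintro _ ⟨m₁, h₁, a, ha, m₂, h₂, rfl⟩
    exact (hXU h₂).2.2.1 _ ((hXU h₁).1 a ha)

/-- The products `nm` link through `[t B s]`. The sets need not be ternary; it suffices that `s s*`
multiplies `B` from the left and `t* t` from the right. -/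
theorem trans {C : Submodule ℂ (L →L[ℂ] L)} {Z : Submodule ℂ (K →L[ℂ] L)} {t : Set (K →L[ℂ] L)}
    (h : IsLink A B Y s) (h' : IsLink B C Z t) :
    IsLink A C
      (Submodule.span ℂ {x | ∃ n ∈ t, ∃ b ∈ B, ∃ m ∈ s, x = n ∘L b ∘L m}).topologicalClosure
      (Set.image2 (fun n m => n ∘L m) t s) := by
  set W : Submodule ℂ (H →L[ℂ] L) :=
    (Submodule.span ℂ {x | ∃ n ∈ t, ∃ b ∈ B, ∃ m ∈ s, x = n ∘L b ∘L m}).topologicalClosure with hW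
  have hWc : IsClosed (W : Set (H →L[ℂ] L)) := Submodule.isClosed_topologicalClosure _
  have hWmem {n b m} (hn : n ∈ t) (hb : b ∈ B) (hm : m ∈ s) : n ∘L b ∘L m ∈ W :=
    Submodule.le_topologicalClosure _ (Submodule.subset_span ⟨n, hn, b, hb, m, hm, rfl⟩)
  -- `B` is generated by products `m₃ a m₄*`, and `m (m₁* (m₃ a)) m₄*` runs through `Y`, `A`, `Y`
  -- and ends in `B`.
  have hss {m m₁ b} (hm : m ∈ s) (hm₁ : m₁ ∈ s) (hb : b ∈ B) : m ∘L adjoint m₁ ∘L b ∈ B := by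
    rw [← comp_assoc]
    refine comp_mem_of_mem_closure_span_left (m ∘L adjoint m₁) h.isClosed_right ?_
      (h.right_subset hb)
    rintro _ ⟨m₃, h₃, a, ha, m₄, h₄, rfl⟩
    have := h.comp_adjoint_mem m₄ h₄ _ (h.comp_mem m hm _
      (h.adjoint_comp_mem m₁ hm₁ _ (h.comp_mem m₃ h₃ a ha)))
    simpa only [comp_assoc] using this
  have htt {n n₁ b} (hn : n ∈ t) (hn₁ : n₁ ∈ t) (hb : b ∈ B) : b ∘L adjoint n ∘L n₁ ∈ B := by
    refine comp_mem_of_mem_closure_span_right (adjoint n ∘L n₁) h'.isClosed_left ?_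
      (h'.left_subset hb)
    rintro _ ⟨n₃, h₃, c, hc, n₄, h₄, rfl⟩
    have := h'.adjoint_comp_mem n₃ h₃ _ (h'.mem_comp n₁ hn₁ _
      (h'.comp_adjoint_mem n hn _ (h'.mem_comp n₄ h₄ c hc)))
    simpa only [comp_assoc] using this
  refine ⟨h'.countable.image2 h.countable _, h.isClosed_left, h'.isClosed_right, hWc, ?_, ?_, ?_,
    ?_, ?_, ?_⟩
  · rintro _ ⟨n, hn, m, hm, rfl⟩ a ha
    refine comp_mem_of_mem_closure_span_left (n ∘L m) hWc ?_ (h.left_subset ha)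
    rintro _ ⟨m₁, h₁, b, hb, m₂, h₂, rfl⟩
    simpa only [comp_assoc] using hWmem hn (hss hm h₁ hb) h₂
  · rintro _ ⟨n, hn, m, hm, rfl⟩ y hy
    refine comp_mem_of_mem_closure_span_left (adjoint (n ∘L m)) h.isClosed_left ?_ hy
    rintro _ ⟨n₁, h₁, b, hb, m₁, hm₁, rfl⟩
    rw [adjoint_comp]
    have := h.adjoint_comp_mem m hm _ (h.mem_comp m₁ hm₁ _
      (h'.adjoint_comp_mem n hn _ (h'.comp_mem n₁ h₁ b hb)))
    simpa only [comp_assoc] using this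
  · rintro _ ⟨n, hn, m, hm, rfl⟩ y hy
    refine comp_mem_of_mem_closure_span_right (adjoint (n ∘L m)) h'.isClosed_right ?_ hy
    rintro _ ⟨n₁, h₁, b, hb, m₁, hm₁, rfl⟩
    rw [adjoint_comp]
    have := h'.comp_adjoint_mem n hn _ (h'.comp_mem n₁ h₁ _
      (h.comp_adjoint_mem m hm _ (h.mem_comp m₁ hm₁ b hb)))
    simpa only [comp_assoc] using this
  · rintro _ ⟨n, hn, m, hm, rfl⟩ c hc
    refine comp_mem_of_mem_closure_span_right (n ∘L m) hWc ?_ (h'.right_subset hc)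
    rintro _ ⟨n₁, h₁, b, hb, n₂, h₂, rfl⟩
    simpa only [comp_assoc] using hWmem h₁ (htt h₂ hn hb) hm
  · intro a ha
    refine Submodule.closure_span_subset
      (P := (Submodule.span ℂ (innerProducts _ (C : Set (L →L[ℂ] L)))).topologicalClosure)
      (Submodule.isClosed_topologicalClosure _) ?_ (h.left_subset ha)
    rintro _ ⟨m₁, h₁, b, hb, m₂, h₂, rfl⟩
    refine (leftComp (adjoint m₁) ∘L rightComp m₂).map_mem_of_mem_closure_span
      (Submodule.isClosed_topologicalClosure _) ?_ (h'.left_subset hb)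
    rintro _ ⟨n₁, k₁, c, hc, n₂, k₂, rfl⟩
    refine Submodule.le_topologicalClosure _ (Submodule.subset_span ⟨_, ⟨n₁, k₁, m₁, h₁, rfl⟩, c,
      hc, _, ⟨n₂, k₂, m₂, h₂, rfl⟩, ?_⟩)
    simp only [adjoint_comp, comp_apply, leftComp_apply, rightComp_apply, comp_assoc]
  · intro c hc
    refine Submodule.closure_span_subset
      (P := (Submodule.span ℂ (outerProducts _ (A : Set (H →L[ℂ] H)))).topologicalClosure)
      (Submodule.isClosed_topologicalClosure _) ?_ (h'.right_subset hc)
    rintro _ ⟨n₁, k₁, b, hb, n₂, k₂, rfl⟩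
    refine (leftComp n₁ ∘L rightComp (adjoint n₂)).map_mem_of_mem_closure_span
      (Submodule.isClosed_topologicalClosure _) ?_ (h.right_subset hb)
    rintro _ ⟨m₁, h₁, a, ha, m₂, h₂, rfl⟩
    refine Submodule.le_topologicalClosure _ (Submodule.subset_span ⟨_, ⟨n₁, k₁, m₁, h₁, rfl⟩, a,
      ha, _, ⟨n₂, k₂, m₂, h₂, rfl⟩, ?_⟩)
    simp only [adjoint_comp, comp_apply, leftComp_apply, rightComp_apply, comp_assoc]

end IsLink

section Units

variable {M : Submodule ℂ (H →L[ℂ] K)} {n : ℕ → (H →L[ℂ] K)}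

/-- A right approximate unit of a TRO `M` is a two-sided approximate unit of `[M* B M]`. -/
theorem tendsto_sum_of_mem_closure_span_innerProducts
    (hlim : ∀ x ∈ M, Tendsto (fun l : ℕ => ∑ i ∈ Finset.range l, x ∘L adjoint (n i) ∘L n i)
      atTop (𝓝 x)) (hn : ∀ l : ℕ, ‖∑ i ∈ Finset.range l, adjoint (n i) ∘L n i‖ ≤ 1)
    {B : Set (K →L[ℂ] K)} {a : H →L[ℂ] H}
    (ha : a ∈ closure (Submodule.span ℂ (innerProducts (M : Set (H →L[ℂ] K)) B) :
      Set (H →L[ℂ] H))) :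
    Tendsto (fun l : ℕ => ∑ i ∈ Finset.range l, a ∘L adjoint (n i) ∘L n i) atTop (𝓝 a) ∧
    Tendsto (fun l : ℕ => ∑ i ∈ Finset.range l, adjoint (n i) ∘L n i ∘L a) atTop (𝓝 a) := by
  let S : ℕ → H →L[ℂ] H := fun l => ∑ i ∈ Finset.range l, adjoint (n i) ∘L n i
  let fr : ℕ → (H →L[ℂ] H) →L[ℂ] (H →L[ℂ] H) := fun l => rightComp (S l)
  let fl : ℕ → (H →L[ℂ] H) →L[ℂ] (H →L[ℂ] H) := fun l => leftComp (S l)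
  have hfr (l : ℕ) : ‖fr l‖ ≤ 1 := (norm_rightComp_le (S l)).trans (hn l)
  have hfl (l : ℕ) : ‖fl l‖ ≤ 1 := (norm_leftComp_le (S l)).trans (hn l)
  have hr (x : H →L[ℂ] H) (l : ℕ) :
      ∑ i ∈ Finset.range l, x ∘L adjoint (n i) ∘L n i = fr l x := (comp_sum _ _ _).symm
  have hl (x : H →L[ℂ] H) (l : ℕ) :
      ∑ i ∈ Finset.range l, adjoint (n i) ∘L n i ∘L x = fl l x := by
    simp only [← comp_assoc]
    exact (sum_comp _ _ _).symm
  simp only [hr, hl]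
  constructor
  · refine tendsto_self_of_mem_closure_span (Eventually.of_forall hfr) ?_ ha
    rintro _ ⟨m₁, h₁, b, hb, m₂, h₂, rfl⟩
    have := ((leftComp (adjoint m₁ ∘L b) : (H →L[ℂ] K) →L[ℂ] (H →L[ℂ] H)).continuous.tendsto
      m₂).comp (hlim m₂ h₂)
    simp only [← hr]
    simpa only [Function.comp_def, leftComp_apply, comp_sum, comp_assoc] using this
  · refine tendsto_self_of_mem_closure_span (Eventually.of_forall hfl) ?_ ha
    rintro _ ⟨m₁, h₁, b, hb, m₂, h₂, rfl⟩
    have := ((rightComp (b ∘L m₂) : (K →L[ℂ] H) →L[ℂ] (H →L[ℂ] H)).continuous.tendsto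
      (adjoint m₁)).comp ((continuous_adjoint.tendsto m₁).comp (hlim m₁ h₁))
    simp only [← hl]
    simpa only [Function.comp_def, rightComp_apply, sum_comp, comp_assoc, adjoint_comp, map_sum,
      adjoint_adjoint] using this

/-- Iterated limits: `a` is the limit of `∑ nᵢ*nᵢa`, and each `nᵢ*nᵢa` is the limit of `∑ⱼ nᵢ*(nᵢ a
nⱼ*)nⱼ`. Thus the countable unit sequence alone generates. -/
theorem mem_closure_span_innerProducts_of_tendsto {A : Set (H →L[ℂ] H)} {B : Set (K →L[ℂ] K)}
    (hA : ∀ a ∈ A,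
      Tendsto (fun l : ℕ => ∑ i ∈ Finset.range l, a ∘L adjoint (n i) ∘L n i) atTop (𝓝 a) ∧
      Tendsto (fun l : ℕ => ∑ i ∈ Finset.range l, adjoint (n i) ∘L n i ∘L a) atTop (𝓝 a))
    (hB : ∀ a ∈ A, ∀ i j, n i ∘L a ∘L adjoint (n j) ∈ B) {s : Set (H →L[ℂ] K)}
    (hs : ∀ i, n i ∈ s) :
    A ⊆ closure (Submodule.span ℂ (innerProducts s B) : Set (H →L[ℂ] H)) := by
  intro a ha
  set P := (Submodule.span ℂ (innerProducts s B)).topologicalClosure with hP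
  have hPc : IsClosed (P : Set (H →L[ℂ] H)) := Submodule.isClosed_topologicalClosure _
  have h1 (i : ℕ) : adjoint (n i) ∘L n i ∘L a ∈ P := by
    have := ((leftComp (adjoint (n i) ∘L n i)).continuous.tendsto _).comp (hA a ha).1
    refine hPc.mem_of_tendsto this (Eventually.of_forall fun l => ?_)
    simp only [Function.comp_def, leftComp_apply, comp_sum]
    refine P.sum_mem fun j _ => Submodule.le_topologicalClosure _ (Submodule.subset_span ?_)
    exact ⟨n i, hs i, _, hB a ha i j, n j, hs j, by simp only [comp_assoc]⟩
  exact hPc.mem_of_tendsto (hA a ha).2 (Eventually.of_forall fun l => P.sum_mem fun i _ => h1 i)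

end Units

theorem SigmaTROEquiv.symm {A : NonUnitalSubalgebra ℂ (H →L[ℂ] H)}
    {B : NonUnitalSubalgebra ℂ (K →L[ℂ] K)} (h : SigmaTROEquiv A B) : SigmaTROEquiv B A := by
  obtain ⟨M, hM, hA, hB⟩ := h
  refine ⟨adjointSubmodule M, hM.conjugate, ?_, ?_⟩
  · have := outerProducts_eq_innerProducts (M : Set (H →L[ℂ] K)) A
    rw [← coe_adjointSubmodule_eq_image] at this
    exact hB.trans (congrArg (fun s => closure (Submodule.span ℂ s : Set (K →L[ℂ] K))) this)
  · have := outerProducts_eq_innerProducts (adjointSubmodule M : Set (K →L[ℂ] H)) B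
    rw [← coe_adjointSubmodule_eq_image, show adjointSubmodule (adjointSubmodule M) = M by
      ext; simp] at this
    exact hA.trans (congrArg (fun s => closure (Submodule.span ℂ s : Set (H →L[ℂ] H))) this.symm)

theorem SigmaTROEquiv.refl {A : NonUnitalSubalgebra ℂ (H →L[ℂ] H)}
    (hA : IsClosed (A : Set (H →L[ℂ] H))) : SigmaTROEquiv A A := by
  have hmem {x : H →L[ℂ] H} : x ∈ Submodule.span ℂ {(1 : H →L[ℂ] H)} ↔ ∃ c : ℂ, c • 1 = x :=
    Submodule.mem_span_singleton
  have hadj (c : ℂ) : adjoint (c • (1 : H →L[ℂ] H)) = (starRingEnd ℂ c) • 1 := by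
    rw [map_smulₛₗ, ← star_eq_adjoint, star_one]
  have hsum (l : ℕ) (hl : 0 < l) (x : H →L[ℂ] H) :
      ∑ i ∈ Finset.range l, (if i = 0 then x else 0) = x := by
    rw [Finset.sum_ite_eq' (Finset.range l) 0 fun _ => x, if_pos (Finset.mem_range.2 hl)]
  have hsum' (l : ℕ) : ‖∑ i ∈ Finset.range l, (if i = 0 then (1 : H →L[ℂ] H) else 0)‖ ≤ 1 := by
    rcases l.eq_zero_or_pos with rfl | hl
    · simp
    · rw [hsum l hl]; exact norm_id_le
  have h1 : adjoint (1 : H →L[ℂ] H) = 1 := star_one _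
  have hunit : (∀ i : ℕ, (if i = 0 then (1 : H →L[ℂ] H) else 0) ∈
      Submodule.span ℂ {(1 : H →L[ℂ] H)}) := fun i => by
    split_ifs
    · exact Submodule.mem_span_singleton_self _
    · exact Submodule.zero_mem _
  have hite (i : ℕ) : (if i = 0 then (1 : H →L[ℂ] H) else 0) ∘L
      adjoint (if i = 0 then (1 : H →L[ℂ] H) else 0) = if i = 0 then 1 else 0 := by
    split_ifs
    · rw [h1]; rfl
    · rw [map_zero, comp_zero]
  have hite' (i : ℕ) : adjoint (if i = 0 then (1 : H →L[ℂ] H) else 0) ∘L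
      (if i = 0 then (1 : H →L[ℂ] H) else 0) = if i = 0 then 1 else 0 := by
    split_ifs
    · rw [h1]; rfl
    · rw [map_zero, comp_zero]
  -- Both unit sequences are `1, 0, 0, …`; their sums are constant from length one on.
  refine ⟨Submodule.span ℂ {1}, ⟨Submodule.closed_of_finiteDimensional _, ?_,
    ⟨fun i => if i = 0 then 1 else 0, hunit, fun x _ => ?_, fun l => ?_⟩,
    ⟨fun i => if i = 0 then 1 else 0, hunit, fun x _ => ?_, fun l => ?_⟩⟩, ?_, ?_⟩
  · intro x hx y hy z hz
    obtain ⟨c, rfl⟩ := hmem.1 hx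
    obtain ⟨d, rfl⟩ := hmem.1 hy
    obtain ⟨e, rfl⟩ := hmem.1 hz
    rw [hadj]
    exact hmem.2 ⟨e * starRingEnd ℂ d * c, by
      ext v; simp [smul_smul]⟩
  · refine tendsto_const_nhds.congr' ?_
    filter_upwards [eventually_gt_atTop 0] with l hl
    simp only [← comp_assoc, hite]
    rw [← sum_comp, hsum l hl]
    rfl
  · simp only [hite]
    exact hsum' l
  · refine tendsto_const_nhds.congr' ?_
    filter_upwards [eventually_gt_atTop 0] with l hl
    simp only [hite']
    rw [← comp_sum, hsum l hl]
    rfl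
  · simp only [hite']
    exact hsum' l
  · refine subset_antisymm (fun a ha => subset_closure (Submodule.subset_span ?_))
      (Submodule.closure_span_subset (P := A.toSubmodule) hA ?_)
    · exact ⟨1, Submodule.mem_span_singleton_self _, a, ha, 1, Submodule.mem_span_singleton_self _,
        by rw [h1]; rfl⟩
    · rintro _ ⟨m₁, h₁, a, ha, m₂, h₂, rfl⟩
      obtain ⟨c, rfl⟩ := hmem.1 h₁
      obtain ⟨d, rfl⟩ := hmem.1 h₂
      rw [hadj, smul_comp, comp_smul, comp_smul]
      exact A.toSubmodule.smul_mem _ (A.toSubmodule.smul_mem _ ha)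
  · refine subset_antisymm (fun a ha => subset_closure (Submodule.subset_span ?_))
      (Submodule.closure_span_subset (P := A.toSubmodule) hA ?_)
    · exact ⟨1, Submodule.mem_span_singleton_self _, a, ha, 1, Submodule.mem_span_singleton_self _,
        by rw [h1]; rfl⟩
    · rintro _ ⟨m₁, h₁, a, ha, m₂, h₂, rfl⟩
      obtain ⟨c, rfl⟩ := hmem.1 h₁
      obtain ⟨d, rfl⟩ := hmem.1 h₂
      rw [hadj, smul_comp, comp_smul, comp_smul]
      exact A.toSubmodule.smul_mem _ (A.toSubmodule.smul_mem _ ha)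

/-- On generators of `[M*BM]` the factor `m₁*m₂` is absorbed into the neighbouring element of `M` by
the triple product. -/
theorem comp_adjoint_comp_mem_of_triple {M : Submodule ℂ (H →L[ℂ] K)}
    (htriple : ∀ x ∈ M, ∀ y ∈ M, ∀ z ∈ M, x ∘L adjoint y ∘L z ∈ M)
    {A : Submodule ℂ (H →L[ℂ] H)} {B : Set (K →L[ℂ] K)}
    (hA : (A : Set (H →L[ℂ] H)) =
      closure (Submodule.span ℂ (innerProducts (M : Set (H →L[ℂ] K)) B) : Set (H →L[ℂ] H)))
    {m₁ m₂ : H →L[ℂ] K} (h₁ : m₁ ∈ M) (h₂ : m₂ ∈ M) {a : H →L[ℂ] H} (ha : a ∈ A) :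
    a ∘L adjoint m₁ ∘L m₂ ∈ A ∧ adjoint m₁ ∘L m₂ ∘L a ∈ A := by
  have hAc : IsClosed (A : Set (H →L[ℂ] H)) := by rw [hA]; exact isClosed_closure
  have hmem {m₁ m₂ : H →L[ℂ] K} {b} (h₁ : m₁ ∈ M) (h₂ : m₂ ∈ M) (hb : b ∈ B) :
      adjoint m₁ ∘L b ∘L m₂ ∈ A := by
    rw [← SetLike.mem_coe, hA]
    exact subset_closure (Submodule.subset_span ⟨m₁, h₁, b, hb, m₂, h₂, rfl⟩)
  have ha' := ha
  rw [← SetLike.mem_coe, hA] at ha'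
  constructor
  · refine comp_mem_of_mem_closure_span_right (adjoint m₁ ∘L m₂) hAc ?_ ha'
    rintro _ ⟨m₃, h₃, b, hb, m₄, h₄, rfl⟩
    simpa only [comp_assoc] using hmem h₃ (htriple _ h₄ _ h₁ _ h₂) hb
  · rw [← comp_assoc]
    refine comp_mem_of_mem_closure_span_left (adjoint m₁ ∘L m₂) hAc ?_ ha'
    rintro _ ⟨m₃, h₃, b, hb, m₄, h₄, rfl⟩
    have := hmem (htriple _ h₃ _ h₂ _ h₁) h₄ hb
    simpa only [adjoint_comp, adjoint_adjoint, comp_assoc] using this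

/-- A σ-strong TRO-equivalence is implemented by a link. -/
theorem IsSigmaTRO.exists_isLink {A : NonUnitalSubalgebra ℂ (H →L[ℂ] H)}
    {B : NonUnitalSubalgebra ℂ (K →L[ℂ] K)} {M : Submodule ℂ (H →L[ℂ] K)} (hM : IsSigmaTRO M)
    (hA : (A : Set (H →L[ℂ] H)) =
      closure (Submodule.span ℂ (innerProducts (M : Set (H →L[ℂ] K)) B) : Set (H →L[ℂ] H)))
    (hB : (B : Set (K →L[ℂ] K)) =
      closure (Submodule.span ℂ (outerProducts (M : Set (H →L[ℂ] K)) A) : Set (K →L[ℂ] K))) :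
    ∃ Y s, s ⊆ (M : Set (H →L[ℂ] K)) ∧ IsLink A.toSubmodule B.toSubmodule Y s := by
  -- `n` gives density in `A`; `k`, a right unit of `M*`, gives density in `B`. The link consists of
  -- `n` and the adjoints of `k`.
  obtain ⟨k, hk, hklim, hkn⟩ := hM.conjugate.exists_right
  obtain ⟨n, hn, hnlim, hnn⟩ := hM.exists_right
  have hAc : IsClosed (A : Set (H →L[ℂ] H)) := by rw [hA]; exact isClosed_closure
  have hBc : IsClosed (B : Set (K →L[ℂ] K)) := by rw [hB]; exact isClosed_closure
  have hmemA {m₁ m₂ : H →L[ℂ] K} {b} (h₁ : m₁ ∈ M) (h₂ : m₂ ∈ M) (hb : b ∈ B) :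
      adjoint m₁ ∘L b ∘L m₂ ∈ A := by
    rw [← SetLike.mem_coe, hA]
    exact subset_closure (Submodule.subset_span ⟨m₁, h₁, b, hb, m₂, h₂, rfl⟩)
  have hmemB {m₁ m₂ : H →L[ℂ] K} {a} (h₁ : m₁ ∈ M) (h₂ : m₂ ∈ M) (ha : a ∈ A) :
      m₁ ∘L a ∘L adjoint m₂ ∈ B := by
    rw [← SetLike.mem_coe, hB]
    exact subset_closure (Submodule.subset_span ⟨m₁, h₁, a, ha, m₂, h₂, rfl⟩)
  have hMM {m₁ m₂ : H →L[ℂ] K} (h₁ : m₁ ∈ M) (h₂ : m₂ ∈ M) {a : H →L[ℂ] H} (ha : a ∈ A) :=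
    comp_adjoint_comp_mem_of_triple (A := A.toSubmodule) hM.triple_mem hA h₁ h₂ ha
  have hsM : Set.range (fun i => adjoint (k i)) ∪ Set.range n ⊆ M := by
    rintro _ (⟨i, rfl⟩ | ⟨i, rfl⟩)
    exacts [hk i, hn i]
  -- `[MA]` also absorbs `BM`, because `B = [MAM*]` and `A M*M ⊆ A`.
  set Y : Submodule ℂ (H →L[ℂ] K) :=
    (Submodule.span ℂ {x | ∃ m₁ ∈ M, ∃ a ∈ A, x = m₁ ∘L a}).topologicalClosure with hY
  have hYc : IsClosed (Y : Set (H →L[ℂ] K)) := Submodule.isClosed_topologicalClosure _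
  have hYmem {m₁ a} (h₁ : m₁ ∈ M) (ha : a ∈ A) : m₁ ∘L a ∈ Y :=
    Submodule.le_topologicalClosure _ (Submodule.subset_span ⟨m₁, h₁, a, ha, rfl⟩)
  refine ⟨Y, Set.range (fun i => adjoint (k i)) ∪ Set.range n, hsM,
    (Set.countable_range _).union (Set.countable_range _),
    hAc, hBc, hYc, fun x hx a ha => hYmem (hsM hx) ha, ?_, ?_, ?_, ?_, ?_⟩
  · intro x hx y hy
    refine comp_mem_of_mem_closure_span_left (adjoint x) hAc ?_ hy
    rintro _ ⟨m₁, h₁, a, ha, rfl⟩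
    exact (hMM (hsM hx) h₁ ha).2
  · intro x hx y hy
    refine comp_mem_of_mem_closure_span_right (adjoint x) hBc ?_ hy
    rintro _ ⟨m₁, h₁, a, ha, rfl⟩
    exact hmemB h₁ (hsM hx) ha
  · intro x hx b hb
    refine comp_mem_of_mem_closure_span_right x hYc ?_ (hB.subset hb)
    rintro _ ⟨m₁, h₁, a, ha, m₂, h₂, rfl⟩
    exact hYmem h₁ (hMM h₂ (hsM hx) ha).1
  · exact mem_closure_span_innerProducts_of_tendsto
      (fun a ha => tendsto_sum_of_mem_closure_span_innerProducts hnlim hnn (hA.subset ha))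
      (fun a ha i j => hmemB (hn i) (hn j) ha) fun i => Or.inr ⟨i, rfl⟩
  · rw [outerProducts_eq_innerProducts]
    refine mem_closure_span_innerProducts_of_tendsto (n := k)
      (fun b hb => tendsto_sum_of_mem_closure_span_innerProducts hklim hkn (B := A) ?_)
      (fun b hb i j => ?_) fun i => ⟨_, Or.inl ⟨i, rfl⟩, adjoint_adjoint _⟩
    · rw [coe_adjointSubmodule_eq_image, ← outerProducts_eq_innerProducts]
      exact hB.subset hb
    · have := hmemA (mem_adjointSubmodule.1 (hk i)) (mem_adjointSubmodule.1 (hk j)) hb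
      rwa [adjoint_adjoint] at this

end Links

/-! ### Countable ampliations and column operators -/

section SquareSummable

variable {H : Type*} [NormedAddCommGroup H] [InnerProductSpace ℂ H] [CompleteSpace H]
variable {K : Type*} [NormedAddCommGroup K] [InnerProductSpace ℂ K] [CompleteSpace K]
variable {V : Type*} [NormedAddCommGroup V] [InnerProductSpace ℂ V] [CompleteSpace V]

/-- The Hilbert space direct sum of countably many copies of `K`. -/
def Ampliation (K : Type*) [NormedAddCommGroup K] : Type _ := lp (fun _ : ℕ => K) 2

noncomputable instance : NormedAddCommGroup (Ampliation K) :=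
  inferInstanceAs (NormedAddCommGroup (lp (fun _ : ℕ => K) 2))

noncomputable instance : InnerProductSpace ℂ (Ampliation K) :=
  inferInstanceAs (InnerProductSpace ℂ (lp (fun _ : ℕ => K) 2))

instance : CompleteSpace (Ampliation K) :=
  inferInstanceAs (CompleteSpace (lp (fun _ : ℕ => K) 2))

/-- The embedding of `K` as the `i`-th summand. -/
noncomputable def summand (K : Type*) [NormedAddCommGroup K] [InnerProductSpace ℂ K] (i : ℕ) :
    K →L[ℂ] Ampliation K :=
  (lp.singleContinuousLinearMap ℂ (fun _ : ℕ => K) 2 i : K →L[ℂ] lp (fun _ : ℕ => K) 2)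

theorem adjoint_summand_apply (i : ℕ) (f : lp (fun _ : ℕ => K) 2) :
    adjoint (summand K i) (f : Ampliation K) = f i := by
  refine ext_inner_left ℂ fun x => ?_
  refine (adjoint_inner_right (summand K i) x (f : Ampliation K)).trans ?_
  exact lp.inner_single_left (𝕜 := ℂ) (G := fun _ : ℕ => K) i x f

theorem isOrthoSystem_summand : IsOrthoSystem (summand K) := by
  refine ⟨fun i => ?_, fun i j hij => ?_⟩
  · ext x
    exact (adjoint_summand_apply i _).trans (lp.single_apply_self (E := fun _ : ℕ => K) 2 i x)
  · ext x
    exact (adjoint_summand_apply i _).trans (lp.single_apply_ne (E := fun _ : ℕ => K) 2 j x hij)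

theorem hasSum_summand (f : Ampliation K) :
    HasSum (fun i => summand K i (adjoint (summand K i) f)) f := by
  have h := lp.hasSum_single (E := fun _ : ℕ => K) (p := 2) (by norm_num)
    (f : lp (fun _ : ℕ => K) 2)
  have h2 (i : ℕ) : adjoint (summand K i) f = (show lp (fun _ : ℕ => K) 2 from f) i :=
    adjoint_summand_apply i f
  simp only [h2]
  exact h

theorem sum_norm_sq_le_of_norm_sum_le {n : ℕ → (H →L[ℂ] K)}
    (hn : ∀ l : ℕ, ‖∑ i ∈ Finset.range l, adjoint (n i) ∘L n i‖ ≤ 1) (s : Finset ℕ) (x : H) :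
    ∑ i ∈ s, ‖n i x‖ ^ 2 ≤ ‖x‖ ^ 2 := by
  obtain ⟨l, hl⟩ := s.exists_nat_subset_range
  refine (Finset.sum_le_sum_of_subset_of_nonneg hl fun _ _ _ => by positivity).trans ?_
  have h1 : (inner ℂ x ((∑ i ∈ Finset.range l, adjoint (n i) ∘L n i) x) : ℂ) =
      ((∑ i ∈ Finset.range l, ‖n i x‖ ^ 2 : ℝ) : ℂ) := by
    rw [sum_apply, inner_sum]
    push_cast
    refine Finset.sum_congr rfl fun i _ => ?_
    change inner ℂ x (adjoint (n i) (n i x)) = _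
    rw [adjoint_inner_right, inner_self_eq_norm_sq_to_K]
    rfl
  have h2 := norm_inner_le_norm (𝕜 := ℂ) x ((∑ i ∈ Finset.range l, adjoint (n i) ∘L n i) x)
  rw [h1, Complex.norm_real, Real.norm_of_nonneg (Finset.sum_nonneg fun _ _ => by positivity)] at h2
  refine h2.trans ?_
  rw [sq]
  gcongr
  simpa using ContinuousLinearMap.le_of_opNorm_le _ (hn l) x

/-- A sequence with contractive partial sums `∑ nᵢ* nᵢ` is a contractive column operator. -/
theorem exists_column {n : ℕ → (H →L[ℂ] K)}
    (hn : ∀ l : ℕ, ‖∑ i ∈ Finset.range l, adjoint (n i) ∘L n i‖ ≤ 1) :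
    ∃ C : H →L[ℂ] Ampliation K, ‖C‖ ≤ 1 ∧ ∀ i, adjoint (summand K i) ∘L C = n i := by
  have h2 : (0 : ℝ) < (2 : ENNReal).toReal := by norm_num
  have hle (x : H) (s : Finset ℕ) :
      ∑ i ∈ s, ‖n i x‖ ^ (2 : ENNReal).toReal ≤ ‖x‖ ^ (2 : ENNReal).toReal := by
    simpa using sum_norm_sq_le_of_norm_sum_le hn s x
  have hmem (x : H) : Memℓp (fun i => n i x) 2 := memℓp_gen' (hle x)
  let C₀ : H →ₗ[ℂ] lp (fun _ : ℕ => K) 2 :=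
    { toFun := fun x => ⟨fun i => n i x, hmem x⟩
      map_add' := fun x y => by
        ext i
        exact map_add (n i) x y
      map_smul' := fun c x => by
        ext i
        exact map_smul (n i) c x }
  have hC (x : H) : ‖C₀ x‖ ≤ 1 * ‖x‖ := by
    rw [one_mul]
    exact lp.norm_le_of_forall_sum_le h2 (norm_nonneg x) (hle x)
  refine ⟨(C₀.mkContinuous 1 hC : H →L[ℂ] lp (fun _ : ℕ => K) 2),
    LinearMap.mkContinuous_norm_le _ zero_le_one _, fun i => ?_⟩
  ext x
  exact adjoint_summand_apply i (C₀ x)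

section Column

variable {n : ℕ → (H →L[ℂ] K)} {C : H →L[ℂ] Ampliation K}
  (hC : ∀ i, adjoint (summand K i) ∘L C = n i) {a : V →L[ℂ] H}
  (ha : Tendsto (fun l : ℕ => ∑ i ∈ Finset.range l, adjoint (n i) ∘L n i ∘L a) atTop (𝓝 a))
include hC

theorem adjoint_column_comp_summand (i : ℕ) : adjoint C ∘L summand K i = adjoint (n i) := by
  rw [← hC, adjoint_comp, adjoint_adjoint]

include ha

/-- `C*C` is the strong sum of `nᵢ*nᵢ`, which the hypothesis evaluates on the range of `a`. -/
theorem adjoint_column_comp_column_comp : adjoint C ∘L C ∘L a = a := by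
  ext v
  have h1 := ((hasSum_summand (C (a v))).map (adjoint C) (adjoint C).continuous).tendsto_sum_nat
  have h2 := ((ContinuousLinearMap.apply ℂ H v).continuous.tendsto a).comp ha
  refine tendsto_nhds_unique h1 (h2.congr fun l => ?_)
  simp only [Function.comp_apply, ContinuousLinearMap.apply_apply, sum_apply, comp_apply]
  refine Finset.sum_congr rfl fun i _ => ?_
  rw [← adjoint_column_comp_summand hC, comp_apply, ← hC, comp_apply]

/-- For the difference `D` one finds `D*D = a*(a - ∑ nᵢ*nᵢa)`, so the convergence is in norm. This
is what brings infinite columns such as `Ca` within reach of finite matrices. -/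
theorem tendsto_truncated_column :
    Tendsto (fun l : ℕ => ∑ i ∈ Finset.range l, summand K i ∘L n i ∘L a) atTop (𝓝 (C ∘L a)) := by
  rw [tendsto_iff_norm_sub_tendsto_zero]
  have hlim : Tendsto (fun l : ℕ => ‖a‖ *
      ‖(∑ i ∈ Finset.range l, adjoint (n i) ∘L n i ∘L a) - a‖) atTop (𝓝 0) := by
    simpa using (tendsto_iff_norm_sub_tendsto_zero.1 ha).const_mul ‖a‖
  have hsq : Tendsto (fun l : ℕ =>
      ‖(∑ i ∈ Finset.range l, summand K i ∘L n i ∘L a) - C ∘L a‖ ^ 2) atTop (𝓝 0) := by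
    refine squeeze_zero (fun _ => by positivity) (fun l => ?_) hlim
    have h1 (i : ℕ) : adjoint (n i) = adjoint C ∘L summand K i :=
      (adjoint_column_comp_summand hC i).symm
    have hCC (v : V) : adjoint C (C (a v)) = a v :=
      congr($(adjoint_column_comp_column_comp hC ha) v)
    have hCn (i : ℕ) (v : H) : adjoint (summand K i) (C v) = n i v := congr($(hC i) v)
    have hnC (i : ℕ) (v : K) : adjoint C (summand K i v) = adjoint (n i) v :=
      congr($(adjoint_column_comp_summand hC i) v)
    have h2 : adjoint ((∑ i ∈ Finset.range l, summand K i ∘L n i ∘L a) - C ∘L a) ∘L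
        ((∑ i ∈ Finset.range l, summand K i ∘L n i ∘L a) - C ∘L a) =
        adjoint a ∘L (a - ∑ i ∈ Finset.range l, adjoint (n i) ∘L n i ∘L a) := by
      ext v
      have h3 : (∑ i ∈ Finset.range l, if i < l then adjoint a (adjoint (n i) (n i (a v))) else 0)
          = ∑ i ∈ Finset.range l, adjoint a (adjoint (n i) (n i (a v))) :=
        Finset.sum_congr rfl fun i hi => if_pos (Finset.mem_range.1 hi)
      simp [adjoint_comp, sum_apply, hCC, hCn, hnC, isOrthoSystem_summand.adjoint_apply_apply,
        map_ite_zero, h3]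
    rw [norm_sq_eq_norm_adjoint_comp, h2]
    refine (opNorm_comp_le _ _).trans_eq ?_
    rw [LinearIsometryEquiv.norm_map, norm_sub_rev]
  simpa using hsq.sqrt

end Column

end SquareSummable

/-! ### The stabilization and the isomorphism between its two realizations -/

namespace OperatorAlgebra

section AmpliationGraph

theorem tendsto_mul_of_mem_closure_span {ι R : Type*} [NormedRing R] [NormedAlgebra ℂ R]
    {l : Filter ι} {e : ι → R} (he : ∀ᶠ i in l, ‖e i‖ ≤ 1) {s : Set R}
    (hs : ∀ x ∈ s, Tendsto (fun i => e i * x) l (𝓝 x) ∧ Tendsto (fun i => x * e i) l (𝓝 x)) {x : R}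
    (hx : x ∈ closure (Submodule.span ℂ s : Set R)) :
    Tendsto (fun i => e i * x) l (𝓝 x) ∧ Tendsto (fun i => x * e i) l (𝓝 x) := by
  constructor
  · exact tendsto_self_of_mem_closure_span (f := fun i => ContinuousLinearMap.mul ℂ R (e i))
      (c := 1) (he.mono fun i hi => (opNorm_mul_apply_le ℂ R _).trans hi) (fun x hx => (hs x hx).1)
      hx
  · refine tendsto_self_of_mem_closure_span
      (f := fun i => (ContinuousLinearMap.mul ℂ R).flip (e i)) (c := 1)
      (he.mono fun i hi => opNorm_le_bound _ zero_le_one fun x => ?_) (fun x hx => (hs x hx).2) hx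
    rw [flip_apply, ContinuousLinearMap.mul_apply', mul_comm (1 : ℝ)]
    exact (norm_mul_le _ _).trans (by gcongr)

variable {B : OperatorAlgebra.{u}}
variable {K : Type*} [NormedAddCommGroup K] [InnerProductSpace ℂ K] [CompleteSpace K]
variable {K' : Type*} [NormedAddCommGroup K'] [InnerProductSpace ℂ K'] [CompleteSpace K']
variable (β : B.carrier →ₙₐ[ℂ] (K →L[ℂ] K)) (β' : B.carrier →ₙₐ[ℂ] (K' →L[ℂ] K'))

/-- The operators on the ampliations of `K` and `K'` whose matrices have the single entry `b`, in
position `(i, j)`. -/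
noncomputable def unitPair (i j : ℕ) (b : B.carrier) :
    (Ampliation K →L[ℂ] Ampliation K) × (Ampliation K' →L[ℂ] Ampliation K') :=
  (summand K i ∘L β b ∘L adjoint (summand K j), summand K' i ∘L β' b ∘L adjoint (summand K' j))

/-- The pairs of finite matrices over the operator algebra, as operators on the ampliations. -/
noncomputable def finiteGraph :
    Submodule ℂ ((Ampliation K →L[ℂ] Ampliation K) × (Ampliation K' →L[ℂ] Ampliation K')) :=
  Submodule.span ℂ {p | ∃ i j b, p = unitPair β β' i j b}

/-- The graph of the isomorphism between the stabilizations of the two images of the operator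
algebra. -/
noncomputable def ampliationGraph :
    Submodule ℂ ((Ampliation K →L[ℂ] Ampliation K) × (Ampliation K' →L[ℂ] Ampliation K')) :=
  (finiteGraph β β').topologicalClosure

theorem isClosed_ampliationGraph : IsClosed (ampliationGraph β β' :
    Set ((Ampliation K →L[ℂ] Ampliation K) × (Ampliation K' →L[ℂ] Ampliation K'))) :=
  Submodule.isClosed_topologicalClosure _

variable {β β'}

theorem unitPair_mem (i j : ℕ) (b : B.carrier) : unitPair β β' i j b ∈ ampliationGraph β β' :=
  Submodule.le_topologicalClosure _ (Submodule.subset_span ⟨i, j, b, rfl⟩)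

theorem unitPair_add (i j : ℕ) (b c : B.carrier) :
    unitPair β β' i j (b + c) = unitPair β β' i j b + unitPair β β' i j c := by
  simp [unitPair]

theorem unitPair_smul (i j : ℕ) (z : ℂ) (b : B.carrier) :
    unitPair β β' i j (z • b) = z • unitPair β β' i j b := by
  simp [unitPair]

theorem unitPair_zero (i j : ℕ) : unitPair β β' i j 0 = 0 := by
  simp [unitPair]

theorem unitPair_mul (i j k l : ℕ) (b c : B.carrier) :
    unitPair β β' i j b * unitPair β β' k l c =
      if j = k then unitPair β β' i l (b * c) else 0 := by
  have h1 (j k : ℕ) (x : K) := isOrthoSystem_summand.adjoint_apply_apply j k x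
  have h2 (j k : ℕ) (x : K') := isOrthoSystem_summand.adjoint_apply_apply j k x
  split_ifs with h
  · ext x : 2
    · simp [unitPair, h1, h]
    · simp [unitPair, h2, h]
  · ext x : 2
    · simp [unitPair, h1, h]
    · simp [unitPair, h2, h]

theorem mem_of_mem_ampliationGraph {F : Type*} [NormedAddCommGroup F] [NormedSpace ℂ F]
    (f : ((Ampliation K →L[ℂ] Ampliation K) × (Ampliation K' →L[ℂ] Ampliation K')) →L[ℂ] F)
    {P : Submodule ℂ F} (hP : IsClosed (P : Set F)) (h : ∀ i j b, f (unitPair β β' i j b) ∈ P)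
    {p} (hp : p ∈ ampliationGraph β β') : f p ∈ P := by
  refine f.map_mem_of_mem_closure_span hP ?_ hp
  rintro _ ⟨i, j, b, rfl⟩
  exact h i j b

theorem mul_mem_ampliationGraph {p q} (hp : p ∈ ampliationGraph β β')
    (hq : q ∈ ampliationGraph β β') : p * q ∈ ampliationGraph β β' := by
  refine mem_of_mem_ampliationGraph ((ContinuousLinearMap.mul ℂ _).flip q)
    (isClosed_ampliationGraph β β') (fun i j b => ?_) hp
  refine mem_of_mem_ampliationGraph (ContinuousLinearMap.mul ℂ _ (unitPair β β' i j b))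
    (isClosed_ampliationGraph β β') (fun k l c => ?_) hq
  rw [ContinuousLinearMap.mul_apply', unitPair_mul]
  split_ifs
  · exact unitPair_mem _ _ _
  · exact zero_mem _

/-- Allowing every large size `k` lets finitely many elements share one size. -/
theorem exists_matrix_of_mem_finiteGraph {p} (hp : p ∈ finiteGraph β β') :
    ∃ (b : ℕ → ℕ → B.carrier) (k₀ : ℕ), ∀ k, k₀ ≤ k →
      p = ∑ i ∈ Finset.range k, ∑ j ∈ Finset.range k, unitPair β β' i j (b i j) := by
  induction hp using Submodule.span_induction with
  | mem p hp =>
    obtain ⟨i, j, b, rfl⟩ := hp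
    refine ⟨fun i' j' => if i' = i then if j' = j then b else 0 else 0, max i j + 1,
      fun k hk => ?_⟩
    rw [Finset.sum_eq_single i, Finset.sum_eq_single j]
    · simp
    · intro j' _ hj
      simp [hj, unitPair_zero]
    · intro hj
      exact absurd (Finset.mem_range.2 (by omega)) hj
    · intro i' _ hi
      simp [hi, unitPair_zero]
    · intro hi
      exact absurd (Finset.mem_range.2 (by omega)) hi
  | zero => exact ⟨0, 0, fun k _ => by simp [unitPair_zero]⟩
  | add p q _ _ hp hq =>
    obtain ⟨b, k₁, hb⟩ := hp
    obtain ⟨c, k₂, hc⟩ := hq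
    refine ⟨b + c, max k₁ k₂, fun k hk => ?_⟩
    rw [hb k ((le_max_left _ _).trans hk), hc k ((le_max_right _ _).trans hk)]
    simp only [Pi.add_apply, unitPair_add, Finset.sum_add_distrib]
  | smul z p _ hp =>
    obtain ⟨b, k₁, hb⟩ := hp
    refine ⟨z • b, k₁, fun k hk => ?_⟩
    rw [hb k hk]
    simp only [Pi.smul_apply, unitPair_smul, Finset.smul_sum]

variable {P : Type*} [NormedAddCommGroup P] [InnerProductSpace ℂ P] [CompleteSpace P]
variable {P' : Type*} [NormedAddCommGroup P'] [InnerProductSpace ℂ P'] [CompleteSpace P']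

theorem blockOperator_sum_summand {n k : ℕ} (F : Fin n → Ampliation K →L[ℂ] P)
    (T : Fin n → Fin n → ℕ → ℕ → K →L[ℂ] K) :
    blockOperator F (fun r s => ∑ i ∈ Finset.range k, ∑ j ∈ Finset.range k,
      summand K i ∘L T r s i j ∘L adjoint (summand K j)) =
    blockOperator (fun q : Fin n × Fin k => F q.1 ∘L summand K q.2)
      (fun q q' => T q.1 q'.1 q.2 q'.2) := by
  simp only [blockOperator, Fintype.sum_prod_type, comp_sum, sum_comp, adjoint_comp, comp_assoc,
    Finset.sum_range]
  refine Finset.sum_congr rfl fun r _ => ?_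
  rw [Finset.sum_comm]

theorem continuous_blockOperator {n : ℕ} {X : Type*} [TopologicalSpace X] {f : X → K →L[ℂ] K}
    (hf : Continuous f) (F : Fin n → K →L[ℂ] P) :
    Continuous fun p : Fin n → Fin n → X => blockOperator F fun r s => f (p r s) :=
  continuous_finsetSum _ fun r _ => continuous_finsetSum _ fun s _ =>
    continuous_const.clm_comp ((hf.comp ((continuous_apply s).comp (continuous_apply r))).clm_comp
      continuous_const)

/-- An `n × n` matrix of `k × k` matrices over `B` is a matrix indexed by `Fin n × Fin k`, to which
complete isometry of `β` and `β'` applies. -/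
theorem norm_blockOperator_eq_of_mem_finiteGraph (h : B.IsCompletelyIsometric β)
    (h' : B.IsCompletelyIsometric β') {n : ℕ} {F : Fin n → Ampliation K →L[ℂ] P}
    (hF : IsOrthoSystem F) {F' : Fin n → Ampliation K' →L[ℂ] P'} (hF' : IsOrthoSystem F')
    {q : Fin n → Fin n → (Ampliation K →L[ℂ] Ampliation K) × (Ampliation K' →L[ℂ] Ampliation K')}
    (hq : ∀ r s, q r s ∈ finiteGraph β β') :
    ‖blockOperator F (fun r s => (q r s).1)‖ = ‖blockOperator F' (fun r s => (q r s).2)‖ := by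
  choose b k₀ hb using fun r s => exists_matrix_of_mem_finiteGraph (hq r s)
  let k := Finset.univ.sup fun r => Finset.univ.sup fun s => k₀ r s
  have hk (r s : Fin n) : k₀ r s ≤ k :=
    (Finset.le_sup (f := fun s => k₀ r s) (Finset.mem_univ s)).trans
      (Finset.le_sup (f := fun r => Finset.univ.sup fun s => k₀ r s) (Finset.mem_univ r))
  have h1 (r s : Fin n) : (q r s).1 = ∑ i ∈ Finset.range k, ∑ j ∈ Finset.range k,
      summand K i ∘L β (b r s i j) ∘L adjoint (summand K j) := by
    rw [congrArg Prod.fst (hb r s k (hk r s))]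
    simp only [Prod.fst_sum, unitPair]
  have h2 (r s : Fin n) : (q r s).2 = ∑ i ∈ Finset.range k, ∑ j ∈ Finset.range k,
      summand K' i ∘L β' (b r s i j) ∘L adjoint (summand K' j) := by
    rw [congrArg Prod.snd (hb r s k (hk r s))]
    simp only [Prod.snd_sum, unitPair]
  simp only [h1, h2]
  have hS : IsOrthoSystem fun q : Fin n × Fin k => F q.1 ∘L summand K q.2 :=
    (isOrthoSystem_summand.comp_injective Fin.val_injective).prod hF
  have hS' : IsOrthoSystem fun q : Fin n × Fin k => F' q.1 ∘L summand K' q.2 :=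
    (isOrthoSystem_summand.comp_injective Fin.val_injective).prod hF'
  have key := h.norm_blockOperator h' hS hS' fun q q' => b q.1 q'.1 q.2 q'.2
  have e1 := blockOperator_sum_summand (k := k) F fun r s i j => β (b r s i j)
  have e2 := blockOperator_sum_summand (k := k) F' fun r s i j => β' (b r s i j)
  rw [e1, e2]
  exact key

/-- The isomorphism between the stabilizations is completely isometric. -/
theorem norm_blockOperator_eq_of_mem (h : B.IsCompletelyIsometric β)
    (h' : B.IsCompletelyIsometric β') {n : ℕ} {F : Fin n → Ampliation K →L[ℂ] P}
    (hF : IsOrthoSystem F) {F' : Fin n → Ampliation K' →L[ℂ] P'} (hF' : IsOrthoSystem F')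
    {p : Fin n → Fin n → (Ampliation K →L[ℂ] Ampliation K) × (Ampliation K' →L[ℂ] Ampliation K')}
    (hp : ∀ r s, p r s ∈ ampliationGraph β β') :
    ‖blockOperator F (fun r s => (p r s).1)‖ = ‖blockOperator F' (fun r s => (p r s).2)‖ := by
  have hmem : p ∈ closure (Set.pi Set.univ fun _ : Fin n => Set.pi Set.univ fun _ : Fin n =>
      SetLike.coe (finiteGraph β β')) := by
    simp only [closure_pi_set, Set.mem_pi]
    exact fun r _ s _ => hp r s
  have hclosed := isClosed_eq (continuous_blockOperator continuous_fst F).norm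
    (continuous_blockOperator continuous_snd F').norm
  refine closure_minimal ?_ hclosed hmem
  intro q hq
  exact norm_blockOperator_eq_of_mem_finiteGraph h h' hF hF' fun r s => hq r trivial s trivial

theorem blockOperator_unique (T : Fin 1 → Fin 1 → P →L[ℂ] P) :
    blockOperator (fun _ : Fin 1 => ContinuousLinearMap.id ℂ P) T = T 0 0 := by
  ext x
  simp [blockOperator, ← star_eq_adjoint, ← one_def]

theorem isIsometricGraph_ampliationGraph (h : B.IsCompletelyIsometric β)
    (h' : B.IsCompletelyIsometric β') : IsIsometricGraph (ampliationGraph β β') where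
  isClosed := isClosed_ampliationGraph β β'
  norm_eq p hp := by
    have := norm_blockOperator_eq_of_mem h h' (n := 1) isOrthoSystem_unique isOrthoSystem_unique
      (p := fun _ _ => p) (fun _ _ => hp)
    rwa [blockOperator_unique, blockOperator_unique] at this
  mul_mem p hp q hq := mul_mem_ampliationGraph hp hq
  exists_approximateUnit := by
    obtain ⟨l, hl, hl1⟩ := B.exists_approximateIdentity
    have := hl.neBot
    -- Diagonal matrices of growing size whose nonzero entries all equal one element of an
    -- approximate unit of `B`. On a single-entry matrix only one diagonal entry matters once the
    -- size exceeds its index.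
    let e : B.carrier × ℕ →
        (Ampliation K →L[ℂ] Ampliation K) × (Ampliation K' →L[ℂ] Ampliation K') :=
      fun q => ∑ i ∈ Finset.range q.2, unitPair β β' i i q.1
    have he1 : ∀ᶠ q in l ×ˢ atTop, ‖e q‖ ≤ 1 := by
      filter_upwards [tendsto_fst.eventually hl1] with q hq
      refine norm_prod_le_iff.2 ⟨?_, ?_⟩
      · simp only [e, Prod.fst_sum, unitPair]
        refine (isOrthoSystem_summand.norm_diagonal_le isOrthoSystem_summand _ _).trans ?_
        rwa [h.norm_map]
      · simp only [e, Prod.snd_sum, unitPair]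
        refine (isOrthoSystem_summand.norm_diagonal_le isOrthoSystem_summand _ _).trans ?_
        rwa [h'.norm_map]
    have hcont (i j : ℕ) : Continuous (unitPair β β' i j) := by
      have h1 : Continuous β := (AddMonoidHomClass.isometry_of_norm β h.norm_map).continuous
      have h2 : Continuous β' := (AddMonoidHomClass.isometry_of_norm β' h'.norm_map).continuous
      exact (continuous_const.clm_comp (h1.clm_comp continuous_const)).prodMk
        (continuous_const.clm_comp (h2.clm_comp continuous_const))
    refine ⟨map e (l ×ˢ atTop), inferInstance, ?_, fun p hp => ?_⟩
    · rw [eventually_map]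
      filter_upwards [he1] with q hq
      exact ⟨Submodule.sum_mem _ fun i _ => unitPair_mem i i q.1, hq⟩
    · rw [tendsto_map'_iff, tendsto_map'_iff]
      refine tendsto_mul_of_mem_closure_span he1 ?_ hp
      rintro _ ⟨i, j, b, rfl⟩
      constructor
      · refine (((hcont i j).tendsto b).comp
          ((hl.tendsto_mul_right b).comp (tendsto_fst (g := atTop)))).congr' ?_
        filter_upwards [tendsto_snd.eventually (eventually_gt_atTop i)] with q hq
        simp only [e, Finset.sum_mul, unitPair_mul, Function.comp]
        rw [Finset.sum_ite_eq' (Finset.range q.2) i, if_pos (Finset.mem_range.2 hq)]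
      · refine (((hcont i j).tendsto b).comp
          ((hl.tendsto_mul_left b).comp (tendsto_fst (g := atTop)))).congr' ?_
        filter_upwards [tendsto_snd.eventually (eventually_gt_atTop j)] with q hq
        simp only [e, Finset.mul_sum, unitPair_mul, Function.comp]
        rw [Finset.sum_ite_eq (Finset.range q.2) j, if_pos (Finset.mem_range.2 hq)]

end AmpliationGraph

end OperatorAlgebra

/-! ### Compressions and rows relative to the stabilization -/

namespace OperatorAlgebra

section Transport

variable {A B : OperatorAlgebra.{u}}
variable {H : Type*} [NormedAddCommGroup H] [InnerProductSpace ℂ H] [CompleteSpace H]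
variable {K : Type*} [NormedAddCommGroup K] [InnerProductSpace ℂ K] [CompleteSpace K]
variable {K' : Type*} [NormedAddCommGroup K'] [InnerProductSpace ℂ K'] [CompleteSpace K']

/-- If the image of `α` is the closed span of `S` and `α'` sends the preimages of `S` into a closed
space, then `α'` takes its values in that space. -/
theorem map_mem_of_range_subset_closure_span {α : A.carrier →ₙₐ[ℂ] (H →L[ℂ] H)}
    {α' : A.carrier →ₙₐ[ℂ] (K →L[ℂ] K)} (h : A.IsCompletelyIsometric α)
    (h' : A.IsCompletelyIsometric α') {S : Set (H →L[ℂ] H)}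
    (hS : (NonUnitalAlgHom.range α : Set (H →L[ℂ] H)) ⊆
      closure (Submodule.span ℂ S : Set (H →L[ℂ] H)))
    {P : Submodule ℂ (K →L[ℂ] K)} (hP : IsClosed (P : Set (K →L[ℂ] K)))
    (hgen : ∀ t ∈ S, ∃ a, α a = t ∧ α' a ∈ P) (a : A.carrier) : α' a ∈ P := by
  have hα : Isometry α := AddMonoidHomClass.isometry_of_norm α h.norm_map
  have hα' : Isometry α' := AddMonoidHomClass.isometry_of_norm α' h'.norm_map
  let Q : Submodule ℂ (H →L[ℂ] H) :=
    (P.comap (α' : A.carrier →ₗ[ℂ] (K →L[ℂ] K))).map (α : A.carrier →ₗ[ℂ] (H →L[ℂ] H))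
  have hQ : IsClosed (Q : Set (H →L[ℂ] H)) :=
    hα.isClosedEmbedding.isClosedMap _ (hP.preimage hα'.continuous)
  obtain ⟨c, hc, hca⟩ := Submodule.closure_span_subset hQ
    (fun t ht => by
      obtain ⟨c, hc, hcP⟩ := hgen t ht
      exact ⟨c, hcP, hc⟩) (hS ⟨a, rfl⟩)
  rw [← hα.injective hca]
  exact hc

variable {β : B.carrier →ₙₐ[ℂ] (K →L[ℂ] K)} {β' : B.carrier →ₙₐ[ℂ] (K' →L[ℂ] K')}

theorem mk_sum_mem {ι E F : Type*} [AddCommGroup E] [AddCommGroup F] [Module ℂ E] [Module ℂ F]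
    {Γ : Submodule ℂ (E × F)} {s : Finset ι} {f : ι → E} {g : ι → F}
    (h : ∀ i ∈ s, (f i, g i) ∈ Γ) : (∑ i ∈ s, f i, ∑ i ∈ s, g i) ∈ Γ := by
  have := Γ.sum_mem h
  rwa [show ∑ i ∈ s, (f i, g i) = (∑ i ∈ s, f i, ∑ i ∈ s, g i) from
    Prod.ext Prod.fst_sum Prod.snd_sum] at this

section Column

variable {n : ℕ → (H →L[ℂ] K)} {C : H →L[ℂ] Ampliation K}
  (hΓ : IsIsometricGraph (ampliationGraph β β')) (hC : ∀ i, adjoint (summand K i) ∘L C = n i)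
include hΓ hC

theorem exists_snd_column_comp {x : Ampliation K →L[ℂ] H}
    (hx : Tendsto (fun l : ℕ => ∑ i ∈ Finset.range l, adjoint (n i) ∘L n i ∘L x) atTop (𝓝 x))
    (h : ∀ i, ∃ y, (summand K i ∘L n i ∘L x, y) ∈ ampliationGraph β β') :
    ∃ y, (C ∘L x, y) ∈ ampliationGraph β β' := by
  refine hΓ.exists_snd_of_tendsto (fun l => ?_) (tendsto_truncated_column hC hx)
  choose y hy using h
  exact ⟨∑ i ∈ Finset.range l, y i, mk_sum_mem fun i _ => hy i⟩

theorem exists_snd_comp_adjoint_column {x : H →L[ℂ] Ampliation K}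
    (hx : Tendsto (fun l : ℕ => ∑ i ∈ Finset.range l, adjoint (n i) ∘L n i ∘L adjoint x) atTop
      (𝓝 (adjoint x)))
    (h : ∀ i, ∃ y, (x ∘L adjoint (n i) ∘L adjoint (summand K i), y) ∈ ampliationGraph β β') :
    ∃ y, (x ∘L adjoint C, y) ∈ ampliationGraph β β' := by
  have h1 := (continuous_adjoint.tendsto _).comp (tendsto_truncated_column hC hx)
  simp only [Function.comp_def, map_sum, adjoint_comp, adjoint_adjoint, comp_assoc] at h1
  refine hΓ.exists_snd_of_tendsto (fun l => ?_) h1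
  choose y hy using h
  exact ⟨∑ i ∈ Finset.range l, y i, mk_sum_mem fun i _ => hy i⟩

/-- `CaC*` has the entries `nᵢ a nⱼ*` in `β(B)`. Truncating the columns and rows one after the other
approximates it in norm by finite matrices. -/
theorem exists_snd_compression {a : H →L[ℂ] H}
    (hl : Tendsto (fun l : ℕ => ∑ i ∈ Finset.range l, adjoint (n i) ∘L n i ∘L a) atTop (𝓝 a))
    (hr : Tendsto (fun l : ℕ => ∑ i ∈ Finset.range l, a ∘L adjoint (n i) ∘L n i) atTop (𝓝 a))
    (h : ∀ i j, ∃ b, n i ∘L a ∘L adjoint (n j) = β b) :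
    ∃ y, (C ∘L a ∘L adjoint C, y) ∈ ampliationGraph β β' := by
  rw [← comp_assoc]
  refine exists_snd_comp_adjoint_column hΓ hC ?_ fun j => ?_
  · have := ((leftComp C : (H →L[ℂ] H) →L[ℂ] (H →L[ℂ] Ampliation K)).continuous.tendsto a).comp hr
    have := (continuous_adjoint.tendsto _).comp this
    simpa only [Function.comp_def, leftComp_apply, comp_sum, map_sum, adjoint_comp,
      adjoint_adjoint, comp_assoc] using this
  · rw [comp_assoc]
    refine exists_snd_column_comp hΓ hC ?_ fun i => ?_
    · have := ((rightComp (adjoint (n j) ∘L adjoint (summand K j)) :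
        (H →L[ℂ] H) →L[ℂ] (Ampliation K →L[ℂ] H)).continuous.tendsto a).comp hl
      simpa only [Function.comp_def, rightComp_apply, sum_comp, comp_assoc] using this
    · obtain ⟨b, hb⟩ := h i j
      have := unitPair_mem (β := β) (β' := β') i j b
      rw [unitPair, ← hb] at this
      exact ⟨_, by simpa only [comp_assoc] using this⟩

variable {M : Submodule ℂ (H →L[ℂ] K)} (hn : ∀ i, n i ∈ M)
  (hlim : ∀ m ∈ M, Tendsto (fun l : ℕ => ∑ i ∈ Finset.range l, adjoint (n i) ∘L n i ∘L adjoint m)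
    atTop (𝓝 (adjoint m)))
  (hl : ∀ m ∈ M, ∀ m' ∈ M, ∀ b, ∃ c, m ∘L adjoint m' ∘L β b = β c)
  (hr : ∀ m ∈ M, ∀ m' ∈ M, ∀ b, ∃ c, β b ∘L m ∘L adjoint m' = β c)
include hn hlim hl hr

/-- The rows of the elements of a TRO are multipliers of the stabilization of `β(B)`, and are
transported to the stabilization of `β'(B)`. -/
theorem exists_row_multiplier {m : H →L[ℂ] K} (hm : m ∈ M) :
    ∃ T' : Ampliation K' →L[ℂ] Ampliation K', ∀ p ∈ ampliationGraph β β',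
      (((summand K 0 ∘L m ∘L adjoint C) * p.1, T' * p.2) ∈ ampliationGraph β β' ∧
        (p.1 * (summand K 0 ∘L m ∘L adjoint C), p.2 * T') ∈ ampliationGraph β β') ∧
      (star (summand K 0 ∘L m ∘L adjoint C) * p.1, star T' * p.2) ∈ ampliationGraph β β' ∧
        (p.1 * star (summand K 0 ∘L m ∘L adjoint C), p.2 * star T') ∈ ampliationGraph β β' := by
  set S : Submodule ℂ (Ampliation K →L[ℂ] Ampliation K) :=
    (ampliationGraph β β').map (LinearMap.fst ℂ _ _) with hS
  have hmemS {x} : x ∈ S ↔ ∃ y, (x, y) ∈ ampliationGraph β β' :=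
    ⟨fun ⟨p, hp, hpx⟩ => ⟨p.2, by rw [← hpx]; exact hp⟩, fun ⟨y, hy⟩ => ⟨_, hy, rfl⟩⟩
  have hSc : IsClosed (S : Set (Ampliation K →L[ℂ] Ampliation K)) := by
    refine IsSeqClosed.isClosed fun f x hf hx => ?_
    exact hmemS.2 (hΓ.exists_snd_of_tendsto (fun i => hmemS.1 (hf i)) hx)
  have hunit (i j : ℕ) (b : B.carrier) : summand K i ∘L β b ∘L adjoint (summand K j) ∈ S :=
    hmemS.2 ⟨_, unitPair_mem i j b⟩
  have hEE (i j : ℕ) {V : Type _} [NormedAddCommGroup V] [NormedSpace ℂ V] (x : V →L[ℂ] K) :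
      adjoint (summand K i) ∘L summand K j ∘L x = if i = j then x else 0 := by
    ext v
    simp only [comp_apply, isOrthoSystem_summand.adjoint_apply_apply]
    split_ifs <;> rfl
  have hCE (i : ℕ) : adjoint C ∘L summand K i = adjoint (n i) := adjoint_column_comp_summand hC i
  have hstar : star (summand K 0 ∘L m ∘L adjoint C) = C ∘L adjoint m ∘L adjoint (summand K 0) := by
    rw [star_eq_adjoint, adjoint_comp, adjoint_comp, adjoint_adjoint, comp_assoc]
  have hleft (T : Ampliation K →L[ℂ] Ampliation K)
      (h : ∀ i j b, T ∘L summand K i ∘L β b ∘L adjoint (summand K j) ∈ S) :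
      ∀ p ∈ ampliationGraph β β', ∃ y, (T * p.1, y) ∈ ampliationGraph β β' := fun p hp =>
    hmemS.1 (mem_of_mem_ampliationGraph (leftComp T ∘L ContinuousLinearMap.fst ℂ _ _) hSc h hp)
  have hright (T : Ampliation K →L[ℂ] Ampliation K)
      (h : ∀ i j b, (summand K i ∘L β b ∘L adjoint (summand K j)) ∘L T ∈ S) :
      ∀ p ∈ ampliationGraph β β', ∃ y, (p.1 * T, y) ∈ ampliationGraph β β' := fun p hp =>
    hmemS.1 (mem_of_mem_ampliationGraph ((rightComp T :
      (Ampliation K →L[ℂ] Ampliation K) →L[ℂ] (Ampliation K →L[ℂ] Ampliation K)) ∘L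
      ContinuousLinearMap.fst ℂ _ _) hSc h hp)
  refine hΓ.exists_multiplier (hleft _ fun i j b => ?_) (hright _ fun i j b => ?_)
    (hleft _ fun i j b => ?_) (hright _ fun i j b => ?_)
  -- `C*` meets summand `i` in `nᵢ*`, so the product is a single entry `m nᵢ* β(b)`.
  · obtain ⟨c, hc⟩ := hl m hm (n i) (hn i) b
    have := hunit 0 j c
    rw [← hc, ← hCE] at this
    simpa only [comp_assoc] using this
  -- Only `j = 0` survives, leaving an infinite row with entries `β(b) m nₖ*`, a norm limit of
  -- finite rows.
  · rw [comp_assoc, comp_assoc, hEE]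
    split_ifs with hj
    · have : (summand K i ∘L β b ∘L m) ∘L adjoint C ∈ S := by
        refine hmemS.2 (exists_snd_comp_adjoint_column hΓ hC ?_ fun k => ?_)
        · have := ((rightComp (adjoint (β b) ∘L adjoint (summand K i)) :
            (K →L[ℂ] H) →L[ℂ] (Ampliation K →L[ℂ] H)).continuous.tendsto _).comp (hlim m hm)
          simpa only [Function.comp_def, rightComp_apply, sum_comp, comp_assoc, adjoint_comp]
            using this
        · obtain ⟨c, hc⟩ := hr m hm (n k) (hn k) b
          have := hunit i k c
          rw [← hc] at this
          exact hmemS.1 (by simpa only [comp_assoc] using this)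
      simpa only [comp_assoc] using this
    · rw [comp_zero, comp_zero]
      exact S.zero_mem
  -- Dually, an infinite column with entries `nₖ m* β(b)`.
  · rw [hstar, comp_assoc, comp_assoc, hEE]
    split_ifs with hj
    · refine hmemS.2 (exists_snd_column_comp hΓ hC ?_ fun k => ?_)
      · have := ((rightComp (β b ∘L adjoint (summand K j)) :
          (K →L[ℂ] H) →L[ℂ] (Ampliation K →L[ℂ] H)).continuous.tendsto _).comp (hlim m hm)
        simpa only [Function.comp_def, rightComp_apply, sum_comp, comp_assoc] using this
      · obtain ⟨c, hc⟩ := hl (n k) (hn k) m hm b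
        have := hunit k j c
        rw [← hc] at this
        exact hmemS.1 (by simpa only [comp_assoc] using this)
    · rw [comp_zero, comp_zero]
      exact S.zero_mem
  · rw [hstar]
    obtain ⟨c, hc⟩ := hr (n j) (hn j) m hm b
    have := hunit i 0 c
    rw [← hc, ← hC j] at this
    simpa only [comp_assoc] using this

end Column

end Transport

end OperatorAlgebra

/-! ### The induced representation and its link to `β'(B)` -/

namespace OperatorAlgebra

section Induction

variable {A B : OperatorAlgebra.{u}}
variable {H : Type*} [NormedAddCommGroup H] [InnerProductSpace ℂ H] [CompleteSpace H]
variable {K : Type*} [NormedAddCommGroup K] [InnerProductSpace ℂ K] [CompleteSpace K]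
variable {K' : Type*} [NormedAddCommGroup K'] [InnerProductSpace ℂ K'] [CompleteSpace K']
variable {α : A.carrier →ₙₐ[ℂ] (H →L[ℂ] H)}
variable {β : B.carrier →ₙₐ[ℂ] (K →L[ℂ] K)} {β' : B.carrier →ₙₐ[ℂ] (K' →L[ℂ] K')}

/-- A column operator `C` which compresses `α(A)` into the stabilization of `β(B)` induces a
completely isometric representation of `A` from `β'`. -/
theorem exists_induced_representation (hα : A.IsCompletelyIsometric α)
    (hβ : B.IsCompletelyIsometric β) (hβ' : B.IsCompletelyIsometric β')
    {C : H →L[ℂ] Ampliation K} (hC : ‖C‖ ≤ 1) (hl : ∀ a, adjoint C ∘L C ∘L α a = α a)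
    (hr : ∀ a, α a ∘L adjoint C ∘L C = α a)
    (hex : ∀ a, ∃ y, (C ∘L α a ∘L adjoint C, y) ∈ ampliationGraph β β') :
    ∃ α' : A.carrier →ₙₐ[ℂ] (Ampliation K' →L[ℂ] Ampliation K'), A.IsCompletelyIsometric α' ∧
      ∀ a, (C ∘L α a ∘L adjoint C, α' a) ∈ ampliationGraph β β' := by
  have hΓ := isIsometricGraph_ampliationGraph hβ hβ'
  choose f hf using hex
  let α' : A.carrier →ₙₐ[ℂ] (Ampliation K' →L[ℂ] Ampliation K') :=
    { toFun := f
      map_smul' := fun c a => hΓ.snd_unique (hf _) (by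
        have := (ampliationGraph β β').smul_mem c (hf a)
        rwa [Prod.smul_mk, ← comp_smul, ← smul_comp, ← map_smul] at this)
      map_zero' := hΓ.snd_unique (hf _) (by
        rw [map_zero, zero_comp, comp_zero]
        exact zero_mem _)
      map_add' := fun a b => hΓ.snd_unique (hf _) (by
        have := (ampliationGraph β β').add_mem (hf a) (hf b)
        rwa [Prod.mk_add_mk, ← comp_add, ← add_comp, ← map_add] at this)
      map_mul' := fun a b => hΓ.snd_unique (hf _) (by
        have h1 := hΓ.mul_mem _ (hf a) _ (hf b)
        -- The inner factor `C*C` is absorbed by `α(b)`.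
        have h2 : (C ∘L α a ∘L adjoint C) * (C ∘L α b ∘L adjoint C) =
            C ∘L α (a * b) ∘L adjoint C := by
          rw [map_mul, mul_def, mul_def]
          conv_rhs => rw [← hl b]
          simp only [comp_assoc]
        rwa [Prod.mk_mul_mk, h2] at h1) }
  refine ⟨α', fun n a => ?_, hf⟩
  have h1 := norm_blockOperator_eq_of_mem hβ hβ'
    (isOrthoSystem_coordEmbedding (H := Ampliation K) n)
    (isOrthoSystem_coordEmbedding (H := Ampliation K') n)
    (p := fun i j => (C ∘L α (a i j) ∘L adjoint C, α' (a i j))) fun i j => hf (a i j)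
  have hC' : ‖adjoint C‖ ≤ 1 := by rwa [LinearIsometryEquiv.norm_map]
  -- Compression by `C` is undone by compression by `C*`; both are contractive at every matrix
  -- level, so norms are preserved.
  have h2 := norm_blockOperator_conj_le (isOrthoSystem_coordEmbedding (H := H) n)
    (isOrthoSystem_coordEmbedding (H := Ampliation K) n) hC hC' (fun i j => α (a i j))
  have h3 := norm_blockOperator_conj_le (isOrthoSystem_coordEmbedding (H := Ampliation K) n)
    (isOrthoSystem_coordEmbedding (H := H) n) hC' hC (fun i j => C ∘L α (a i j) ∘L adjoint C)
  have h4 (a : A.carrier) : adjoint C ∘L (C ∘L α a ∘L adjoint C) ∘L C = α a := by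
    calc _ = (adjoint C ∘L C ∘L α a) ∘L adjoint C ∘L C := by simp only [comp_assoc]
      _ = _ := by rw [hl, hr]
  simp only [h4] at h3
  have h5 := hα n a
  rw [matrixOperator_eq_blockOperator] at h5 ⊢
  exact (h1.symm.trans (h2.antisymm h3)).trans h5

/-- Multiplying both coordinates by the projection onto row `i` preserves the graph. It fixes the
first coordinate, hence the second by uniqueness of partners. -/
theorem summand_comp_adjoint_comp_snd (hΓ : IsIsometricGraph (ampliationGraph β β')) {i : ℕ}
    {z : Ampliation K →L[ℂ] K} {w : Ampliation K' →L[ℂ] Ampliation K'}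
    (hz : (summand K i ∘L z, w) ∈ ampliationGraph β β') :
    summand K' i ∘L adjoint (summand K' i) ∘L w = w := by
  have hE (v : K) : adjoint (summand K i) (summand K i v) = v :=
    congr($(isOrthoSystem_summand.1 i) v)
  have hE' (v : K') : adjoint (summand K' i) (summand K' i v) = v :=
    congr($(isOrthoSystem_summand.1 i) v)
  have h1 := mem_of_mem_ampliationGraph
    (((leftComp (summand K i ∘L adjoint (summand K i)) :
      (Ampliation K →L[ℂ] Ampliation K) →L[ℂ] _) ∘L ContinuousLinearMap.fst ℂ _ _).prod
    ((leftComp (summand K' i ∘L adjoint (summand K' i)) :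
      (Ampliation K' →L[ℂ] Ampliation K') →L[ℂ] _) ∘L ContinuousLinearMap.snd ℂ _ _))
    (isClosed_ampliationGraph β β') (fun j k b => ?_) hz
  · have h2 : (summand K i ∘L adjoint (summand K i)) ∘L summand K i ∘L z = summand K i ∘L z := by
      ext v
      simp only [comp_apply, hE]
    have h3 : ((summand K i ∘L adjoint (summand K i)) ∘L summand K i ∘L z,
        (summand K' i ∘L adjoint (summand K' i)) ∘L w) ∈ ampliationGraph β β' := h1
    rw [h2, comp_assoc] at h3
    exact hΓ.snd_unique h3 hz
  · change ((summand K i ∘L adjoint (summand K i)) ∘L summand K j ∘L β b ∘L adjoint (summand K k),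
      (summand K' i ∘L adjoint (summand K' i)) ∘L summand K' j ∘L β' b ∘L
        adjoint (summand K' k)) ∈ _
    by_cases hj : i = j
    · subst hj
      convert unitPair_mem (β := β) (β' := β') i k b using 1
      refine Prod.ext ?_ ?_ <;> ext v
      · exact congrArg (summand K i) (hE _)
      · exact congrArg (summand K' i) (hE' _)
    · convert zero_mem (ampliationGraph β β') using 1
      refine Prod.ext ?_ ?_ <;> ext v <;>
        simp [isOrthoSystem_summand.adjoint_apply_apply, hj]

set_option maxHeartbeats 1000000 in
/-- Links from `α(A)` to `β(B)` induce links from representations of `A` to `β'(B)`, for every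
completely isometric representation `β'` of `B`. -/
theorem exists_isLink_of_sigmaTROEquiv (hα : A.IsCompletelyIsometric α)
    (hβ : B.IsCompletelyIsometric β) (hβ' : B.IsCompletelyIsometric β')
    (h : SigmaTROEquiv (NonUnitalAlgHom.range α) (NonUnitalAlgHom.range β)) :
    ∃ α' : A.carrier →ₙₐ[ℂ] (Ampliation K' →L[ℂ] Ampliation K'), A.IsCompletelyIsometric α' ∧
      ∃ Y s, IsLink (NonUnitalAlgHom.range α').toSubmodule (NonUnitalAlgHom.range β').toSubmodule
        Y s := by
  obtain ⟨M, hM, hA, hB⟩ := h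
  obtain ⟨Y, s, hsM, hY⟩ := hM.exists_isLink hA hB
  obtain ⟨n, hn, hnlim, hnn⟩ := hM.exists_right
  obtain ⟨C, hC1, hC⟩ := exists_column hnn
  have hΓ := isIsometricGraph_ampliationGraph hβ hβ'
  have hMadj (m) (hm : m ∈ M) : Tendsto
      (fun l : ℕ => ∑ i ∈ Finset.range l, adjoint (n i) ∘L n i ∘L adjoint m) atTop
      (𝓝 (adjoint m)) := by
    have := (continuous_adjoint.tendsto _).comp (hnlim m hm)
    simpa only [Function.comp_def, map_sum, adjoint_comp, adjoint_adjoint, comp_assoc] using this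
  have hAlim (a : A.carrier) := tendsto_sum_of_mem_closure_span_innerProducts hnlim hnn
    (B := NonUnitalAlgHom.range β) (a := α a) (hA.subset ⟨a, rfl⟩)
  have hl (a : A.carrier) : adjoint C ∘L C ∘L α a = α a :=
    adjoint_column_comp_column_comp hC (hAlim a).2
  have hr (a : A.carrier) : α a ∘L adjoint C ∘L C = α a := by
    have h1 := (continuous_adjoint.tendsto _).comp (hAlim a).1
    simp only [Function.comp_def, map_sum, adjoint_comp, adjoint_adjoint, comp_assoc] at h1
    have h2 := congrArg adjoint (adjoint_column_comp_column_comp hC h1)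
    simpa only [adjoint_comp, adjoint_adjoint, comp_assoc] using h2
  have hmemB {m₁ m₂ : H →L[ℂ] K} (h₁ : m₁ ∈ M) (h₂ : m₂ ∈ M) (a : A.carrier) :
      ∃ b, m₁ ∘L α a ∘L adjoint m₂ = β b := by
    have : m₁ ∘L α a ∘L adjoint m₂ ∈ NonUnitalAlgHom.range β := by
      rw [← SetLike.mem_coe, hB]
      exact subset_closure (Submodule.subset_span ⟨m₁, h₁, _, ⟨a, rfl⟩, m₂, h₂, rfl⟩)
    obtain ⟨b, hb⟩ := this
    exact ⟨b, hb.symm⟩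
  obtain ⟨α', hα', hΓα⟩ := exists_induced_representation hα hβ hβ' hC1 hl hr fun a =>
    exists_snd_compression hΓ hC (hAlim a).2 (hAlim a).1 fun i j => hmemB (hn i) (hn j) a
  have hB' : ((NonUnitalAlgHom.range β).toSubmodule : Set (K →L[ℂ] K)) = closure (Submodule.span ℂ
      (innerProducts (adjointSubmodule M : Set (K →L[ℂ] H)) (NonUnitalAlgHom.range α)) :
      Set (K →L[ℂ] K)) := by
    rw [coe_adjointSubmodule_eq_image, ← outerProducts_eq_innerProducts]
    exact hB
  have hBM {m₁ m₂ : H →L[ℂ] K} (h₁ : m₁ ∈ M) (h₂ : m₂ ∈ M) (b : B.carrier) :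
      (∃ c, β b ∘L m₁ ∘L adjoint m₂ = β c) ∧ ∃ c, m₁ ∘L adjoint m₂ ∘L β b = β c := by
    have := comp_adjoint_comp_mem_of_triple hM.conjugate.triple_mem hB'
      (m₁ := adjoint m₁) (m₂ := adjoint m₂) (by simpa using h₁) (by simpa using h₂)
      (a := β b) ⟨b, rfl⟩
    rw [adjoint_adjoint] at this
    obtain ⟨⟨c, hc⟩, ⟨d, hd⟩⟩ := this
    exact ⟨⟨c, hc.symm⟩, ⟨d, hd.symm⟩⟩
  choose! T hT using fun m (hm : m ∈ M) => exists_row_multiplier hΓ hC hn hMadj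
    (fun m₁ h₁ m₂ h₂ b => (hBM h₁ h₂ b).2) (fun m₁ h₁ m₂ h₂ b => (hBM h₁ h₂ b).1) hm
  set G := summand K 0 with hG
  set G' := summand K' 0 with hG'
  have hGG (v : K) : adjoint G (G v) = v := congr($(isOrthoSystem_summand.1 0) v)
  have hGG' (v : K') : adjoint G' (G' v) = v := congr($(isOrthoSystem_summand.1 0) v)
  have hlv (a : A.carrier) (v : H) : adjoint C (C (α a v)) = α a v := congr($(hl a) v)
  have hrv (a : A.carrier) (v : H) : α a (adjoint C (C v)) = α a v := congr($(hr a) v)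
  have hMv {m : H →L[ℂ] K} (hm : m ∈ M) (v : K) : adjoint C (C (adjoint m v)) = adjoint m v :=
    congr($(adjoint_column_comp_column_comp hC (hMadj m hm)) v)
  have hstar (m : H →L[ℂ] K) : star (G ∘L m ∘L adjoint C) = C ∘L adjoint m ∘L adjoint G := by
    rw [star_eq_adjoint, adjoint_comp, adjoint_comp, adjoint_adjoint, comp_assoc]
  have hcorner {z : Ampliation K →L[ℂ] K} {w : Ampliation K' →L[ℂ] Ampliation K'}
      (hz : (G ∘L z, w) ∈ ampliationGraph β β') : G' ∘L adjoint G' ∘L w = w :=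
    summand_comp_adjoint_comp_snd hΓ hz
  have hbb (b : B.carrier) : (G ∘L β b ∘L adjoint G, G' ∘L β' b ∘L adjoint G') ∈
      ampliationGraph β β' := unitPair_mem 0 0 b
  -- The intermediate space is transported through `y ↦ G y C*`; its partners are read off in row 0
  -- by removing `G'`.
  set Y' : Submodule ℂ (Ampliation K' →L[ℂ] K') := (Submodule.span ℂ
    {y' | ∃ y ∈ Y, (G ∘L y ∘L adjoint C, G' ∘L y') ∈ ampliationGraph β β'}).topologicalClosure
    with hY'
  have hY'c : IsClosed (Y' : Set (Ampliation K' →L[ℂ] K')) :=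
    Submodule.isClosed_topologicalClosure _
  have hY'mem {y' y} (hy : y ∈ Y) (h : (G ∘L y ∘L adjoint C, G' ∘L y') ∈ ampliationGraph β β') :
      y' ∈ Y' := Submodule.le_topologicalClosure _ (Submodule.subset_span ⟨y, hy, h⟩)
  have hadjx (m : H →L[ℂ] K) : adjoint (adjoint G' ∘L T m) = star (T m) ∘L G' := by
    rw [adjoint_comp, adjoint_adjoint, star_eq_adjoint]
  -- The product `(G m₁ C*)* (G β(b) G*) (G m₂ C*)` equals `C α(a) C*`, and partners in the graph
  -- are unique.
  have hinner {m₁ m₂ : H →L[ℂ] K} (h₁ : m₁ ∈ M) (h₂ : m₂ ∈ M) {b : B.carrier} {a : A.carrier}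
      (hab : adjoint m₁ ∘L β b ∘L m₂ = α a) :
      adjoint (adjoint G' ∘L T m₁) ∘L β' b ∘L adjoint G' ∘L T m₂ = α' a := by
    have h3 := (hT m₁ h₁ _ (hT m₂ h₂ _ (hbb b)).1.2).2.1
    have h4 : star (G ∘L m₁ ∘L adjoint C) * ((G ∘L β b ∘L adjoint G) * (G ∘L m₂ ∘L adjoint C)) =
        C ∘L α a ∘L adjoint C := by
      rw [hstar, ← hab]
      ext v
      simp only [mul_def, comp_apply, hGG]
    rw [h4] at h3
    rw [hadjx, ← hΓ.snd_unique h3 (hΓα a)]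
    rfl
  have houter {m₁ m₂ : H →L[ℂ] K} (h₁ : m₁ ∈ M) (h₂ : m₂ ∈ M) {b : B.carrier} {a : A.carrier}
      (hab : m₁ ∘L α a ∘L adjoint m₂ = β b) :
      (adjoint G' ∘L T m₁) ∘L α' a ∘L adjoint (adjoint G' ∘L T m₂) = β' b := by
    have h3 := (hT m₁ h₁ _ (hT m₂ h₂ _ (hΓα a)).2.2).1.1
    have h4 : (G ∘L m₁ ∘L adjoint C) * ((C ∘L α a ∘L adjoint C) * star (G ∘L m₂ ∘L adjoint C)) =
        G ∘L β b ∘L adjoint G := by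
      rw [hstar, ← hab]
      ext v
      simp only [mul_def, comp_apply, hlv, hrv]
    rw [h4] at h3
    have h5 (v : Ampliation K') : T m₁ (α' a (star (T m₂) v)) = G' (β' b (adjoint G' v)) :=
      congr($(hΓ.snd_unique h3 (hbb b)) v)
    rw [hadjx]
    ext v
    simp only [comp_apply, h5, hGG']
  -- `T m` transports `G m C*`. Since `α'` already acts on the ampliation, only the row embedding
  -- has to be stripped off.
  refine ⟨α', hα', Y', (fun m => adjoint G' ∘L T m) '' s, hY.countable.image _,
    hα'.isClosed_range, hβ'.isClosed_range, hY'c, ?_, ?_, ?_, ?_, ?_, ?_⟩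
  · rintro _ ⟨m, hm, rfl⟩ _ ⟨a, rfl⟩
    have h1 := (hT m (hsM hm) _ (hΓα a)).1.1
    have h2 : (G ∘L m ∘L adjoint C) * (C ∘L α a ∘L adjoint C) =
        G ∘L (m ∘L α a) ∘L adjoint C := by
      ext v
      simp only [mul_def, comp_apply, hlv]
    rw [h2] at h1
    refine hY'mem (hY.comp_mem m hm _ ⟨a, rfl⟩) ?_
    change (_, G' ∘L adjoint G' ∘L (T m * α' a)) ∈ _
    rw [show G' ∘L adjoint G' ∘L (T m * α' a) = T m * α' a from hcorner h1]
    exact h1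
  · rintro _ ⟨m, hm, rfl⟩ y hy
    refine comp_mem_of_mem_closure_span_left _ hα'.isClosed_range ?_ hy
    rintro y' ⟨y, hy, hyy⟩
    obtain ⟨a, ha⟩ := hY.adjoint_comp_mem m hm y hy
    have h1 := (hT m (hsM hm) _ hyy).2.1
    have h2 : star (G ∘L m ∘L adjoint C) * (G ∘L y ∘L adjoint C) = C ∘L α a ∘L adjoint C := by
      rw [hstar, show α a = adjoint m ∘L y from ha]
      ext v
      simp only [mul_def, comp_apply, hGG]
    rw [h2] at h1
    refine ⟨a, ?_⟩
    rw [hadjx]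
    exact hΓ.snd_unique (hΓα a) h1
  · rintro _ ⟨m, hm, rfl⟩ y hy
    refine comp_mem_of_mem_closure_span_right _ hβ'.isClosed_range ?_ hy
    rintro y' ⟨y, hy, hyy⟩
    obtain ⟨b, hb⟩ := hY.comp_adjoint_mem m hm y hy
    have h1 := (hT m (hsM hm) _ hyy).2.2
    have h2 : (G ∘L y ∘L adjoint C) * star (G ∘L m ∘L adjoint C) = G ∘L β b ∘L adjoint G := by
      rw [hstar, show β b = y ∘L adjoint m from hb]
      ext v
      simp only [mul_def, comp_apply, hMv (hsM hm)]
    rw [h2] at h1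
    have h3 (v : Ampliation K') : G' (y' (star (T m) v)) = G' (β' b (adjoint G' v)) :=
      congr($(hΓ.snd_unique h1 (hbb b)) v)
    refine ⟨b, ?_⟩
    rw [hadjx]
    ext v
    have h4 := congrArg (adjoint G') (h3 (G' v))
    rw [hGG', hGG', hGG'] at h4
    exact h4.symm
  · rintro _ ⟨m, hm, rfl⟩ _ ⟨b, rfl⟩
    have h1 := (hT m (hsM hm) _ (hbb b)).1.2
    have h2 : (G ∘L β b ∘L adjoint G) * (G ∘L m ∘L adjoint C) =
        G ∘L (β b ∘L m) ∘L adjoint C := by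
      ext v
      simp only [mul_def, comp_apply, hGG]
    rw [h2] at h1
    exact hY'mem (hY.mem_comp m hm _ ⟨b, rfl⟩) h1
  · rintro _ ⟨a, rfl⟩
    -- Density is carried from `α(A)` to `α'(A)` by the isometry between them, so only generators
    -- need checking.
    refine map_mem_of_range_subset_closure_span hα hα' hY.left_subset
      (P := (Submodule.span ℂ _).topologicalClosure) (Submodule.isClosed_topologicalClosure _) ?_ a
    rintro _ ⟨m₁, h₁, _, ⟨b, rfl⟩, m₂, h₂, rfl⟩
    obtain ⟨a, ha⟩ := hY.adjoint_comp_mem m₁ h₁ _ (hY.mem_comp m₂ h₂ _ ⟨b, rfl⟩)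
    refine ⟨a, ha, Submodule.le_topologicalClosure _ (Submodule.subset_span
      ⟨_, ⟨m₁, h₁, rfl⟩, β' b, ⟨b, rfl⟩, _, ⟨m₂, h₂, rfl⟩, ?_⟩)⟩
    exact (hinner (hsM h₁) (hsM h₂) ha.symm).symm
  · rintro _ ⟨b, rfl⟩
    refine map_mem_of_range_subset_closure_span hβ hβ' hY.right_subset
      (P := (Submodule.span ℂ _).topologicalClosure) (Submodule.isClosed_topologicalClosure _) ?_ b
    rintro _ ⟨m₁, h₁, _, ⟨a, rfl⟩, m₂, h₂, rfl⟩
    obtain ⟨b, hb⟩ := hmemB (hsM h₁) (hsM h₂) a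
    refine ⟨b, hb.symm, Submodule.le_topologicalClosure _ (Submodule.subset_span
      ⟨_, ⟨m₁, h₁, rfl⟩, α' a, ⟨a, rfl⟩, _, ⟨m₂, h₂, rfl⟩, ?_⟩)⟩
    exact (houter (hsM h₁) (hsM h₂) hb).symm

end Induction

/-! ### The three properties of an equivalence relation -/

theorem SigmaStrongDeltaEquiv.refl (A : OperatorAlgebra.{u}) : A.SigmaStrongDeltaEquiv A := by
  obtain ⟨H, _, _, _, α, hα⟩ := A.exists_representation
  have hα' : A.IsCompletelyIsometric α := hα
  exact ⟨H, _, _, inferInstance, H, _, _, inferInstance, α, α, hα, hα,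
    SigmaTROEquiv.refl hα'.isClosed_range⟩

theorem SigmaStrongDeltaEquiv.symm {A B : OperatorAlgebra.{u}} (h : A.SigmaStrongDeltaEquiv B) :
    B.SigmaStrongDeltaEquiv A := by
  obtain ⟨H, _, _, _, K, _, _, _, α, β, hα, hβ, h⟩ := h
  exact ⟨K, _, _, inferInstance, H, _, _, inferInstance, β, α, hβ, hα, h.symm⟩

/-- Only the representation of `A` is changed: the first equivalence is induced along `β'`, so both
links meet in `β'(B)` and can be composed. -/
theorem SigmaStrongDeltaEquiv.trans {A B C : OperatorAlgebra.{u}} (h : A.SigmaStrongDeltaEquiv B)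
    (h' : B.SigmaStrongDeltaEquiv C) : A.SigmaStrongDeltaEquiv C := by
  obtain ⟨H, _, _, _, K, _, _, _, α, β, hα, hβ, h⟩ := h
  obtain ⟨K', _, _, _, L, _, _, _, β', γ, hβ', hγ, h'⟩ := h'
  obtain ⟨α', hα', Y, s, hY⟩ := exists_isLink_of_sigmaTROEquiv hα hβ hβ' h
  obtain ⟨M, hM, hB, hC⟩ := h'
  obtain ⟨Z, t, -, hZ⟩ := hM.exists_isLink hB hC
  exact ⟨Ampliation K', _, _, inferInstance, L, _, _, inferInstance, α', γ, hα', hγ,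
    (hY.trans hZ).sigmaTROEquiv⟩

end OperatorAlgebra

theorem theorem3p4 :
    Equivalence (fun A B : OperatorAlgebra.{u} => A.SigmaStrongDeltaEquiv B) := by
  exact ⟨OperatorAlgebra.SigmaStrongDeltaEquiv.refl, OperatorAlgebra.SigmaStrongDeltaEquiv.symm,
    OperatorAlgebra.SigmaStrongDeltaEquiv.trans⟩
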